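/- **Setting.** Let $V$ be a finite connected graph and $\phi:V\to V$ a basepoint-preserving, $\pi_1$-injective map that sends vertices to vertices and each edge $e$ to a nontrivial combinatorial path: $e$ has a subdivision whose open edges are mapped linearly onto open edges of $V$. Let $X=V\times[0,1]/(x,1)\sim(\phi(x),0)$ be the mapping torus, with its 2-cells $R_e$ ($e$ an edge of $V$) and horizontal edges $t_w$ ($w$ a vertex), and let $\widetilde X$ be its universal cover. Give each edge $e$ of $V$ a weight $|e|>0$ and each horizontal edge weight $1$; let $\mathsf d$ be the induced path metric on the 1-skeleton $\widetilde X^1$. Assume that $(\widetilde X^1,\mathsf d)$ is $\delta$-hyperbolic (geodesic triangles are $\delta$-slim). Let $\widetilde V,\widetilde E\subset\widetilde X$ be the preimages of $V\times\{0\}$ and $V\times\{\frac12\}$; for $x\in\widetilde V$ write $x'$ for the corresponding point of $\widetilde E$. Let $\tilde\phi:\widetilde V\to\widetilde V$ be the forward flow; the midsegment $m_x$ joins $x$ to $\tilde\phi(x)$ along the flow, and the forward path $\sigma_M(x)$ is $m_x m_{\tilde\phi(x)}\cdots m_{\tilde\phi^{M-1}(x)}$. For $S\subset\widetilde X$ let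 $N(S)$ be the smallest subcomplex containing $S$, and let $\mathcal N_r$ denote closed $r$-neighbourhoods in $\widetilde X^1$. Let $\lambda\ge 0$ be the least constant such that $N(\sigma)^1$ is $\lambda$-quasiconvex in $\widetilde X^1$ for each forward path $\sigma$. A subset $Y\subset\widetilde X^1$, with its path metric $\mathsf d_Y$, is $(\kappa_1,\kappa_2)$-quasi-isometrically embedded (where $\kappa_1\ge1$, $\kappa_2\ge0$) if $\kappa_1^{-1}\mathsf d_Y-\kappa_2\le\mathsf d\le\kappa_1\mathsf d_Y+\kappa_2$ on $Y$. **Walls.** Let $L\ge1$ be an integer (the *tunnel length*), let $e_1,\dots,e_k$ be distinct edges of $V$, and let $d_i$ (the *primary busts*) be a nontrivial closed interval in the interior of $e_i$, with endpoints $q_i^\pm$, such that $\bigcup_i d_i$ is disjoint from $(\phi^L)^{-1}(\bigcup_i d_i)$. The *nucleus* is $V$ (placed at height $\frac12$) minus the interiors of all $d_i$ and all components of the $(\phi^L)^{-1}(d_i)$. The tunnel $T_i^\pm$ is the union of the *level-part*, consisting of the flow lines from the points $x'$ with $\phi^L(x)=q_i^\pm$ to its root $q_i^\pm$, and of the *slope*,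 a segment in $R_{e_i}$ from $q_i^\pm$ to $(q_i^\mp)'$. Attaching the tunnels to the nucleus at the points $x'$ and $(q_i^\mp)'$ yields a graph $W^\bullet$ with a map to $X$; an *immersed wall* $W\to X$ is a component of $W^\bullet$. Let $\overline W\subset\widetilde X$ be the image of a lift $\widetilde W\to\widetilde X$ of the universal cover of $W$; it is a union of lifts of components of the nucleus, level-parts and slopes. A *knockout* $\widetilde K$ of $\overline W$ is a maximal connected subspace of $\overline W$ containing no interior point of a slope. The *approximation* $\mathbf A:\overline W\to\widetilde X$ sends a point $x'$ of a lifted nucleus to $\tilde\phi^L(x)$, sends each level-part to its root, and sends a slope, from $q$ to $p'$, onto the concatenation of the lifted bust joining $q$ to $p$ and the forward path $\sigma_L(p)$. A set $\mathbb W$ of immersed walls (with arbitrary tunnel lengths and busts) is *uniformly sub-quasiconvex* with constants $\mu_1,\mu_2$ if, for each $W\in\mathbb W$ and each knockout $\widetilde K$ of $\overline W$, the subspace $\mathbf A(\widetilde K)$ is $(\mu_1,\mu_2)$-quasi-isometrically embedded in $\widetilde X^1$. It has the *ladder overlap property* with constant $B$ if, for each $W\in\mathbb W$ and all distinct tunnels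 $T_1,T_2$ of $\overline W$ meeting a common knockout of $\overline W$, $$\operatorname{diam}\bigl(\mathcal N_{3\delta+2\lambda}(N(\mathbf A(T_1))^1)\cap\mathcal N_{3\delta+2\lambda}(N(\mathbf A(T_2))^1)\bigr)\le B.$$ **Proposition.** For all $\mu_1,\mu_2,B$ there are $L_0,\kappa_1,\kappa_2$ with the following property. Let $\mathbb W$ be a set of immersed walls that is uniformly sub-quasiconvex with constants $\mu_1,\mu_2$ and has the ladder overlap property with constant $B$. Then, for each $W\in\mathbb W$ of tunnel length at least $L_0$, the 1-skeleton $N(\mathbf A(\overline W))^1$ is $(\kappa_1,\kappa_2)$-quasi-isometrically embedded in $\widetilde X^1$. (In particular, the constants do not depend on the tunnel length or on the busts.) -/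

import Mathlib

open Set
open scoped ENNReal

noncomputable section

/-- A graph with vertex set `V` and edge set `E`, each edge carrying a chosen orientation; loops and
multiple edges are allowed.  A pair `(e, true)` is the edge `e` traversed from `src e` to `tgt e`,
and `(e, false)` is the same edge traversed backwards. -/
structure OGraph (V E : Type*) where
  src : E → V
  tgt : E → V

namespace OGraph

variable {V E : Type*} (G : OGraph V E)

def origin (d : E × Bool) : V := cond d.2 (G.src d.1) (G.tgt d.1)

def terminus (d : E × Bool) : V := cond d.2 (G.tgt d.1) (G.src d.1)

/-- `G.IsWalk a p b`: the list `p` of oriented edges is a combinatorial path from `a` to `b`. -/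
def IsWalk : V → List (E × Bool) → V → Prop
  | a, [], b => a = b
  | a, d :: p, b => G.origin d = a ∧ IsWalk (G.terminus d) p b

theorem IsWalk.append {a b c : V} {p q : List (E × Bool)} (hp : G.IsWalk a p b)
    (hq : G.IsWalk b q c) : G.IsWalk a (p ++ q) c := by
  induction p generalizing a with
  | nil => cases hp; exact hq
  | cons d p ih => exact ⟨hp.1, ih hp.2⟩

theorem IsWalk.take {a b : V} {p : List (E × Bool)} (hp : G.IsWalk a p b) (i : ℕ)
    (hi : i < p.length) : G.IsWalk a (p.take i) (G.origin p[i]) := by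
  induction p generalizing a i with
  | nil => exact absurd hi (Nat.not_lt_zero _)
  | cons d p ih =>
    cases i with
    | zero => exact hp.1.symm
    | succ i => exact ⟨hp.1, ih hp.2 i (by simpa using hi)⟩

end OGraph

/-- A based combinatorial self-map `φ : V → V` of a connected graph, injective on `π₁`, with a
weighting of the edges.  (Finiteness of the graph is assumed in the theorem.)

* `mapV` is `φ` on vertices and fixes the basepoint;
* `mapE e` is the nontrivial combinatorial path `φ(e)`;
* `0 = brk e 0 < brk e 1 < ⋯ < brk e n = 1`, with `n` the number of edges of `φ(e)`, are the vertices
  of the subdivision of `e ≅ [0, 1]`; `φ` maps the `i`-th piece linearly onto the `i`-th edge of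
  `φ(e)`;
* `len e` is the weight of `e`.

Homotopy rel endpoints of combinatorial paths in a graph is equality of the words they spell in
the free group on the edges; hence `injective` says that `φ` is injective on `π₁(V, base)`. -/
structure GraphMap (V E : Type*) extends OGraph V E where
  base : V
  connected : ∀ w, ∃ p, toOGraph.IsWalk base p w
  mapV : V → V
  mapV_base : mapV base = base
  mapE : E → List (E × Bool)
  mapE_ne_nil : ∀ e, mapE e ≠ []
  mapE_isWalk : ∀ e, toOGraph.IsWalk (mapV (src e)) (mapE e) (mapV (tgt e))
  injective : ∀ p, toOGraph.IsWalk base p base →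
    FreeGroup.lift (fun e => FreeGroup.mk (mapE e)) (FreeGroup.mk p) = 1 → FreeGroup.mk p = 1
  brk : E → ℕ → ℝ
  brk_zero : ∀ e, brk e 0 = 0
  brk_length : ∀ e, brk e (mapE e).length = 1
  brk_strictMono : ∀ e, StrictMonoOn (brk e) (Iic (mapE e).length)
  len : E → ℝ
  len_pos : ∀ e, 0 < len e

namespace GraphMap

variable {V E : Type*} (φ : GraphMap V E)

/-! ### The mapping torus `X` and its universal cover `X̃` -/

/-- The 1-skeleton of the mapping torus `X` of `φ`: the vertical edges `inl e` are the edges of `V`,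
and the horizontal edge `inr w` is `t_w`, which goes from `w` to `φ(w)`. -/
def torusGraph : OGraph V (E ⊕ V) where
  src := Sum.elim φ.src id
  tgt := Sum.elim φ.tgt φ.mapV

/-- A path of `V`, regarded as a path of `X`. -/
def vert (p : List (E × Bool)) : List ((E ⊕ V) × Bool) := p.map fun d => (Sum.inl d.1, d.2)

theorem vert_isWalk {a b : V} {p : List (E × Bool)} (hp : φ.toOGraph.IsWalk a p b) :
    φ.torusGraph.IsWalk a (vert p) b := by
  induction p generalizing a with
  | nil => exact hp
  | cons d p ih => exact ⟨hp.1, ih hp.2⟩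

/-- Elementary homotopies of edge paths of `X`: removing a backtrack, and pushing a path across the
2-cell `R_e`, whose boundary reads `e t_b = t_a φ(e)` for an edge `e` from `a` to `b`. -/
inductive ElemHomotopy : List ((E ⊕ V) × Bool) → List ((E ⊕ V) × Bool) → Prop
  | backtrack (p q : List ((E ⊕ V) × Bool)) (c : E ⊕ V) (b : Bool) :
      ElemHomotopy (p ++ ((c, b) :: (c, !b) :: q)) (p ++ q)
  | cell (p q : List ((E ⊕ V) × Bool)) (e : E) :
      ElemHomotopy (p ++ ((Sum.inl e, true) :: (Sum.inr (φ.tgt e), true) :: q))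
        (p ++ ((Sum.inr (φ.src e), true) :: (vert (φ.mapE e) ++ q)))

/-- The vertices of the universal cover `X̃` lying over the vertex `w`: homotopy classes (rel
endpoints) of edge paths of `X` from the basepoint to `w`. -/
def Fiber (w : V) : Type _ :=
  Quot fun p q : {p // φ.torusGraph.IsWalk φ.base p w} => φ.ElemHomotopy p.1 q.1

variable {φ}

/-- The terminal vertex of the lift, starting at the vertex `u` of `X̃`, of the edge path `p`. -/
def Fiber.traverse {a b : V} (u : φ.Fiber a) (p : List ((E ⊕ V) × Bool))
    (hp : φ.torusGraph.IsWalk a p b) : φ.Fiber b :=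
  Quot.map (fun r => ⟨r.1 ++ p, r.2.append _ hp⟩) (by
    rintro ⟨r, hr⟩ ⟨s, hs⟩ (h : φ.ElemHomotopy r s)
    change φ.ElemHomotopy (r ++ p) (s ++ p)
    cases h with
    | backtrack x y c b =>
      simpa [List.append_assoc] using ElemHomotopy.backtrack (φ := φ) x (y ++ p) c b
    | cell x y e =>
      simpa [List.append_assoc] using ElemHomotopy.cell (φ := φ) x (y ++ p) e) u

variable (φ)

/-- An edge of `X̃` lying over a vertical edge of `X`. -/
structure LiftEdge where
  edge : E
  start : φ.Fiber (φ.src edge)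

/-- The points of the preimage in `X̃` of `V ⊂ X` (the disjoint union of the trees `Ṽ_n` and their
translates). The point `inner e s` divides the edge `e ≅ [0, 1]` at `s`. -/
inductive VPoint where
  | vertex {w : V} (u : φ.Fiber w) : VPoint
  | inner (e : φ.LiftEdge) (s : Ioo (0 : ℝ) 1) : VPoint

variable {φ}

/-- The terminal vertex of a lifted edge. -/
def LiftEdge.finish (e : φ.LiftEdge) : φ.Fiber (φ.tgt e.edge) :=
  e.start.traverse [(Sum.inl e.edge, true)] ⟨rfl, rfl⟩

/-- The point with parameter `s ∈ [0, 1]` of a lifted edge. -/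
def LiftEdge.pt (e : φ.LiftEdge) (s : ℝ) : φ.VPoint :=
  if h : s ∈ Ioo (0 : ℝ) 1 then .inner e ⟨s, h⟩
  else if s ≤ 0 then .vertex e.start else .vertex e.finish

/-- The endpoint of the horizontal edge that starts at `u`. -/
def Fiber.shift {w : V} (u : φ.Fiber w) : φ.Fiber (φ.mapV w) :=
  u.traverse [(Sum.inr w, true)] ⟨rfl, rfl⟩

/-- The point at parameter `s` on the lift, starting at the vertex `u`, of the oriented edge `d`. -/
def Fiber.along : (d : E × Bool) → φ.Fiber (φ.toOGraph.origin d) → ℝ → φ.VPoint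
  | (e, true), u, s => LiftEdge.pt ⟨e, u⟩ s
  | (e, false), u, s => LiftEdge.pt ⟨e, u.traverse [(Sum.inl e, false)] ⟨rfl, rfl⟩⟩ (1 - s)

variable (φ)

open Classical in
/-- The index `i` of the piece `[brk e i, brk e (i+1)]` of `e` that contains `s ∈ (0, 1)`. -/
def piece (e : E) (s : ℝ) : ℕ :=
  Nat.findGreatest (fun i => φ.brk e i ≤ s) ((φ.mapE e).length - 1)

theorem piece_lt (e : E) (s : ℝ) : φ.piece e s < (φ.mapE e).length :=
  lt_of_le_of_lt (Nat.findGreatest_le _)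
    (Nat.sub_lt (List.length_pos_of_ne_nil (φ.mapE_ne_nil e)) Nat.one_pos)

/-- The forward flow `φ̃`, on the preimage of `V`. -/
def flow : φ.VPoint → φ.VPoint
  | .vertex u => .vertex u.shift
  | .inner e s =>
    let i := φ.piece e.edge s
    Fiber.along ((φ.mapE e.edge)[i]'(φ.piece_lt e.edge s))
      (e.start.shift.traverse (vert ((φ.mapE e.edge).take i))
        (φ.vert_isWalk ((φ.mapE_isWalk e.edge).take _ i (φ.piece_lt e.edge s))))
      ((s - φ.brk e.edge i) / (φ.brk e.edge (i + 1) - φ.brk e.edge i))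

/-- The points of the universal cover `X̃`. As `X` is obtained from `V × [0, 1]` by identifying
`(x, 1)` with `(φ(x), 0)`, each point of `X̃` is `(x, h)` for unique `x` over `V` and `h ∈ [0, 1)`.
The segment from `(x, 0)` through the points `(x, h)` to `(φ̃(x), 0)` is the midsegment of `x`. -/
abbrev Pt := φ.VPoint × Ico (0 : ℝ) 1

variable {φ}

/-- A point over `V`, regarded as a point of `X̃`. -/
def VPoint.toPt (x : φ.VPoint) : φ.Pt := (x, ⟨0, le_rfl, one_pos⟩)

variable (φ)

/-- `Z ⊆ X̃` contains the closure of every open cell that it meets. The cells of `X̃` are its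
vertices, the vertical edges, the horizontal edges (points `(vertex u, h)`, `0 < h`) and the
2-cells (points `(inner e s, h)`, `0 < h`). -/
structure IsSubcomplex (Z : Set φ.Pt) : Prop where
  vertical : ∀ (e : φ.LiftEdge) (s : Ioo (0 : ℝ) 1), (VPoint.inner e s).toPt ∈ Z →
    ∀ r ∈ Icc (0 : ℝ) 1, (e.pt r).toPt ∈ Z
  horizontal : ∀ {w : V} (u : φ.Fiber w) (h : Ico (0 : ℝ) 1), 0 < h.1 →
    (VPoint.vertex u, h) ∈ Z →
      (∀ h', (VPoint.vertex u, h') ∈ Z) ∧ (VPoint.vertex u.shift).toPt ∈ Z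
  cell : ∀ (e : φ.LiftEdge) (s : Ioo (0 : ℝ) 1) (h : Ico (0 : ℝ) 1), 0 < h.1 →
    (VPoint.inner e s, h) ∈ Z → ∀ r ∈ Icc (0 : ℝ) 1,
      (∀ h', (e.pt r, h') ∈ Z) ∧ (φ.flow (e.pt r)).toPt ∈ Z

/-- The carrier `N(S)`: the smallest subcomplex of `X̃` containing `S`. -/
def carrier (S : Set φ.Pt) : Set φ.Pt := ⋂₀ {Z | φ.IsSubcomplex Z ∧ S ⊆ Z}

/-! ### The metric graph `X̃¹` -/

/-- The points of the 1-skeleton `X̃¹`. -/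
def Skel : Type _ := {p : φ.Pt // p.2.1 = 0 ∨ ∃ (w : V) (u : φ.Fiber w), p.1 = .vertex u}

/-- The part of `S ⊆ X̃` that lies in `X̃¹`. -/
def inSkel (S : Set φ.Pt) : Set φ.Skel := {p | p.1 ∈ S}

variable {φ}

def VPoint.toSkel (x : φ.VPoint) : φ.Skel := ⟨x.toPt, .inl rfl⟩

variable (φ)

/-- The edges of `X̃`: vertical ones, and the horizontal edge starting at each vertex. -/
abbrev CoverEdge := φ.LiftEdge ⊕ (Σ w, φ.Fiber w)

/-- The point with parameter `s ∈ [0, 1]` of an edge of `X̃`. -/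
def edgePt : φ.CoverEdge → ℝ → φ.Skel
  | .inl e, s => (e.pt s).toSkel
  | .inr ⟨_, u⟩, s =>
    if h : s ∈ Ico (0 : ℝ) 1 then ⟨(.vertex u, ⟨s, h⟩), .inr ⟨_, u, rfl⟩⟩
    else (VPoint.vertex u.shift).toSkel

/-- The weight of an edge of `X̃`; horizontal edges have weight `1`. -/
def edgeLen : φ.CoverEdge → ℝ
  | .inl e => φ.len e.edge
  | .inr _ => 1

/-- `φ.PathIn Y x y ℓ`: there is a path of length `ℓ` from `x` to `y` inside `Y ⊆ X̃¹`, which is a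
concatenation of finitely many (possibly partial, possibly degenerate) edges. -/
inductive PathIn (Y : Set φ.Skel) : φ.Skel → φ.Skel → ℝ≥0∞ → Prop
  | refl (x : φ.Skel) : x ∈ Y → PathIn Y x x 0
  | cons (c : φ.CoverEdge) (s t : ℝ) (hs : s ∈ Icc (0 : ℝ) 1) (ht : t ∈ Icc (0 : ℝ) 1)
      (hY : ∀ r ∈ uIcc s t, φ.edgePt c r ∈ Y) (y : φ.Skel) (ℓ : ℝ≥0∞) :
      PathIn Y (φ.edgePt c t) y ℓ →
        PathIn Y (φ.edgePt c s) y (ENNReal.ofReal (|s - t| * φ.edgeLen c) + ℓ)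

/-- The path metric of `Y ⊆ X̃¹`: the infimum of the lengths of the paths inside `Y`. -/
def pathDist (Y : Set φ.Skel) (x y : φ.Skel) : ℝ≥0∞ := ⨅ (ℓ : ℝ≥0∞) (_ : φ.PathIn Y x y ℓ), ℓ

variable {φ}

theorem PathIn.trans {Y : Set φ.Skel} {x y z : φ.Skel} {k l : ℝ≥0∞} (h : φ.PathIn Y x y k)
    (h' : φ.PathIn Y y z l) : φ.PathIn Y x z (k + l) := by
  induction h with
  | refl x hx => simpa using h'
  | cons c s t hs ht hY y ℓ _ ih =>
    rw [add_assoc]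
    exact .cons c s t hs ht hY z _ (ih h')

theorem PathIn.symm {Y : Set φ.Skel} {x y : φ.Skel} {k : ℝ≥0∞} (h : φ.PathIn Y x y k) :
    φ.PathIn Y y x k := by
  induction h with
  | refl x hx => exact .refl x hx
  | cons c s t hs ht hY y ℓ _ ih =>
    have h1 := PathIn.cons (Y := Y) c t s ht hs (by rwa [uIcc_comm]) _ _
      (.refl _ (hY s left_mem_uIcc))
    rw [add_zero, abs_sub_comm] at h1
    rw [add_comm]
    exact ih.trans h1

theorem pathDist_comm (Y : Set φ.Skel) (x y : φ.Skel) : φ.pathDist Y x y = φ.pathDist Y y x :=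
  le_antisymm (le_iInf₂ fun ℓ h => iInf₂_le ℓ h.symm) (le_iInf₂ fun ℓ h => iInf₂_le ℓ h.symm)

theorem pathDist_triangle (Y : Set φ.Skel) (x y z : φ.Skel) :
    φ.pathDist Y x z ≤ φ.pathDist Y x y + φ.pathDist Y y z := by
  unfold pathDist
  simp only [ENNReal.iInf_add, ENNReal.add_iInf]
  exact le_iInf₂ fun k hk => le_iInf₂ fun l hl => iInf₂_le _ (PathIn.trans ‹_› ‹_›)

/-- The path metric `d` of `X̃¹`. -/
instance : PseudoEMetricSpace φ.Skel where
  edist := φ.pathDist univ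
  edist_self x := le_antisymm (iInf₂_le 0 (.refl x (mem_univ x))) bot_le
  edist_comm := pathDist_comm univ
  edist_triangle := pathDist_triangle univ

variable (φ)

/-- The inclusion into `X̃¹` of `Y`, with its path metric, is a `(κ₁, κ₂)`-quasi-isometric embedding:
`κ₁⁻¹ d_Y - κ₂ ≤ d ≤ κ₁ d_Y + κ₂`. -/
def IsQIEmbedded (κ₁ κ₂ : ℝ) (Y : Set φ.Skel) : Prop :=
  1 ≤ κ₁ ∧ 0 ≤ κ₂ ∧ ∀ x ∈ Y, ∀ y ∈ Y,
    φ.pathDist Y x y ≤ ENNReal.ofReal κ₁ * (edist x y + ENNReal.ofReal κ₂) ∧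
    edist x y ≤ ENNReal.ofReal κ₁ * φ.pathDist Y x y + ENNReal.ofReal κ₂

/-- `γ` restricted to `[0, D]` is a geodesic of `X̃¹`. -/
def IsGeodesic (γ : ℝ → φ.Skel) (D : ℝ) : Prop :=
  0 ≤ D ∧ ∀ s ∈ Icc 0 D, ∀ t ∈ Icc 0 D, edist (γ s) (γ t) = ENNReal.ofReal |s - t|

/-- `X̃¹` is `δ`-hyperbolic: each side of each geodesic triangle lies in the `δ`-neighbourhood of the
union of the two other sides. -/
def IsHyperbolic (δ : ℝ) : Prop :=
  0 ≤ δ ∧ ∀ (γ₁ γ₂ γ₃ : ℝ → φ.Skel) (D₁ D₂ D₃ : ℝ),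
    φ.IsGeodesic γ₁ D₁ → φ.IsGeodesic γ₂ D₂ → φ.IsGeodesic γ₃ D₃ →
    γ₁ D₁ = γ₂ 0 → γ₂ D₂ = γ₃ 0 → γ₃ D₃ = γ₁ 0 →
    γ₁ '' Icc 0 D₁ ⊆ Metric.cthickening δ (γ₂ '' Icc 0 D₂ ∪ γ₃ '' Icc 0 D₃)

/-- `Y` is `r`-quasiconvex: each geodesic of `X̃¹` with endpoints in `Y` lies in the closed
`r`-neighbourhood of `Y`. -/
def IsQuasiconvex (r : ℝ) (Y : Set φ.Skel) : Prop :=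
  ∀ (γ : ℝ → φ.Skel) (D : ℝ), φ.IsGeodesic γ D → γ 0 ∈ Y → γ D ∈ Y →
    γ '' Icc 0 D ⊆ Metric.cthickening r Y

/-! ### Forward ladders -/

/-- The forward path `σ_M(x)`: the union of the midsegments of `x, φ̃(x), …, φ̃^{M-1}(x)`, ending at
`φ̃^M(x)`. -/
def forwardPath (M : ℕ) (x : φ.VPoint) : Set φ.Pt :=
  {p | ∃ i < M, p.1 = φ.flow^[i] x} ∪ {(φ.flow^[M] x).toPt}

/-- The quasiconvexity constant `λ` of forward ladders: the least `r ≥ 0` such that the 1-skeleton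
of each forward ladder `N(σ)` is `r`-quasiconvex in `X̃¹`. -/
def ladderConst : ℝ :=
  sInf {r | 0 ≤ r ∧ ∀ (M : ℕ) (x : φ.VPoint),
    φ.IsQuasiconvex r (φ.inSkel (φ.carrier (φ.forwardPath M x)))}

/-! ### Immersed walls -/

/-- The primary busts and the tunnel length that determine the graph `W^•` immersed in `X`: a
closed interval `d = [lo e, hi e]` in the interior of each edge `e` of a set `busted` of edges of
`V`, and an integer `L ≥ 1`, such that the union of the primary busts is disjoint from its preimage
under `φ^L`, that is, from the secondary busts (in `disjoint` this is expressed with lifts to `X̃`,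
on which `φ̃` covers `φ`). -/
structure Busts where
  busted : Set E
  lo : E → ℝ
  hi : E → ℝ
  lo_pos : ∀ e ∈ busted, 0 < lo e
  lo_lt_hi : ∀ e ∈ busted, lo e < hi e
  hi_lt_one : ∀ e ∈ busted, hi e < 1
  L : ℕ
  one_le_L : 1 ≤ L
  disjoint : ∀ e e' : φ.LiftEdge, e.edge ∈ busted → e'.edge ∈ busted →
    ∀ s ∈ Icc (lo e.edge) (hi e.edge), ∀ s' ∈ Icc (lo e'.edge) (hi e'.edge),
      φ.flow^[L] (e.pt s) ≠ e'.pt s'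

/-- The points of the graph `V`. -/
abbrev BasePt (_ : GraphMap V E) := V ⊕ E × Ioo (0 : ℝ) 1

variable {φ}

/-- The covering map, on the preimage of `V`. -/
def VPoint.proj : φ.VPoint → φ.BasePt
  | .vertex (w := w) _ => .inl w
  | .inner e s => .inr (e.edge, s)

namespace Busts

variable (D : φ.Busts)

/-- The preimage in `X̃` of the open primary busts of `V`. -/
def openBust : Set φ.VPoint :=
  {x | ∃ e : φ.LiftEdge, e.edge ∈ D.busted ∧
    ∃ s ∈ Ioo (D.lo e.edge) (D.hi e.edge), x = e.pt s}

/-- The preimage in `X̃` of the nucleus, that is, of the complement of the open primary and the open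
secondary busts. The point `(x, 1/2)` is written `x` (the nucleus is a subspace of the parallel copy
`E ≅ V` of `V` at height `1/2`). -/
def nucleus : Set φ.VPoint := {x | x ∉ D.openBust ∧ φ.flow^[D.L] x ∉ D.openBust}

/-- The endpoints of primary busts in `X̃`: an endpoint of the bust in the lifted edge `e`, the upper
one if `b = true` and the lower one if `b = false`. They are the roots of the tunnels. -/
structure Root where
  edge : φ.LiftEdge
  mem : edge.edge ∈ D.busted
  upper : Bool

variable {D}

/-- The point `q` at which the tunnel is rooted. -/
def Root.q (τ : D.Root) : φ.VPoint :=
  τ.edge.pt (cond τ.upper (D.hi τ.edge.edge) (D.lo τ.edge.edge))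

/-- The other endpoint `p` of the same bust. -/
def Root.p (τ : D.Root) : φ.VPoint :=
  τ.edge.pt (cond τ.upper (D.lo τ.edge.edge) (D.hi τ.edge.edge))

variable (D)

/-- The pieces of the preimage in `X̃` of `W^•`: the points of nuclei, the level-parts and the
slopes. The tunnel of `τ` is the union of the level-part and of the slope of `τ`; here

* the level-part is the union of the forward paths from the points `(x, 1/2)` with `φ̃^L(x) = τ.q` to
  the root `(τ.q, 0)` (and is the root alone if there is no such `x`);
* the slope is a segment, in the 2-cell of the edge `τ.edge`, from `(τ.q, 0)` to `(τ.p, 1/2)`. -/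
inductive Piece where
  | nucleusPt (x : φ.VPoint)
  | level (τ : D.Root)
  | slope (τ : D.Root)

/-- Two points of a common component of the preimage of the nucleus are joined, and so are a
level-part and its leaves. -/
inductive LevelJoin : D.Piece → D.Piece → Prop
  | nucleus (x y : φ.VPoint) (ℓ : ℝ≥0∞) :
      φ.PathIn (VPoint.toSkel '' D.nucleus) x.toSkel y.toSkel ℓ →
        LevelJoin (.nucleusPt x) (.nucleusPt y)
  | leaf (x : φ.VPoint) (τ : D.Root) : φ.flow^[D.L] x = τ.q → LevelJoin (.nucleusPt x) (.level τ)

/-- All the attachments of pieces that take place in `W^•`: those of `LevelJoin`, and the slope of a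
tunnel is attached to its level-part at `τ.q` and to the nucleus at `τ.p`. -/
inductive Join : D.Piece → D.Piece → Prop
  | ofLevel (a b : D.Piece) : D.LevelJoin a b → Join a b
  | root (τ : D.Root) : Join (.level τ) (.slope τ)
  | tip (τ : D.Root) : Join (.slope τ) (.nucleusPt τ.p)

/-- The pieces of `W̄`, where `W̄` is the image in `X̃` of the lift through the nucleus point `c` of the
universal cover of a component `W` of `W^•`. (The image is that of a component of the cover
`W^• ×_X X̃` of `W^•`; its pieces are those that one reaches from `c` through attachments. Slopes of
`W̄` that merely cross each other in a 2-cell are not attached to each other.) -/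
def wallPieces (c : φ.VPoint) : Set D.Piece := {a | Relation.EqvGen D.Join (.nucleusPt c) a}

/-- The pieces of the knockout containing `a`, where `a` is a nucleus point or a level-part. -/
def knockoutOf (a : D.Piece) : Set D.Piece := {b | Relation.EqvGen D.LevelJoin a b}

/-- `K` is (the set of pieces of) a knockout of `W̄`: a maximal connected part of `W̄` containing no
interior point of a slope. -/
def IsKnockout (c : φ.VPoint) (K : Set D.Piece) : Prop :=
  ∃ a ∈ D.wallPieces c, (∀ τ, a ≠ .slope τ) ∧ K = D.knockoutOf a

/-- The tunnel of `τ` meets the knockout `K`, either in its level-part or in the tip of its slope. -/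
def Meets (τ : D.Root) (K : Set D.Piece) : Prop := .level τ ∈ K ∨ .nucleusPt τ.p ∈ K

/-- The image of a piece under the approximation map `A`: a nucleus is pushed forward by `φ̃^L`,
a level-part is sent to its root, and a slope is sent to the concatenation of the primary bust,
from `τ.q` to `τ.p`, and of the forward path of length `L` from `τ.p`. -/
def approx : D.Piece → Set φ.Pt
  | .nucleusPt x => {(φ.flow^[D.L] x).toPt}
  | .level τ => {τ.q.toPt}
  | .slope τ => (fun s => (τ.edge.pt s).toPt) '' Icc (D.lo τ.edge.edge) (D.hi τ.edge.edge) ∪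
      φ.forwardPath D.L τ.p

/-- The image under `A` of a union of pieces. -/
def approxSet (S : Set D.Piece) : Set φ.Pt := ⋃ a ∈ S, D.approx a

/-- The 1-skeleton of the carrier of the approximation of the tunnel of `τ`. -/
def tunnelCarrier (τ : D.Root) : Set φ.Skel :=
  φ.inSkel (φ.carrier (D.approxSet {.level τ, .slope τ}))

end Busts

variable (φ)

/-- An immersed wall `W → X`: the component of `W^•` that contains the point `point` of the
nucleus. -/
structure ImmersedWall extends φ.Busts where
  point : φ.BasePt
  point_mem : ∀ c : φ.VPoint, c.proj = point → c ∈ toBusts.nucleus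

variable {φ}

/-- The 1-skeleton `N(A(W̄))¹` of the carrier of the approximation of `W̄`, where `W̄` is the image of
the lift through `c` of the universal cover of `W`. -/
def ImmersedWall.approxCarrier (W : φ.ImmersedWall) (c : φ.VPoint) : Set φ.Skel :=
  φ.inSkel (φ.carrier (W.approxSet (W.wallPieces c)))

variable (φ)

/-- The set `𝕎` of immersed walls is uniformly sub-quasiconvex with constants `μ₁, μ₂`: the
approximation of each knockout of each `W̄` is `(μ₁, μ₂)`-quasi-isometrically embedded. -/
def UniformlySubQuasiconvex (μ₁ μ₂ : ℝ) (𝕎 : Set φ.ImmersedWall) : Prop :=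
  ∀ W ∈ 𝕎, ∀ c : φ.VPoint, c.proj = W.point → ∀ K, W.IsKnockout c K →
    φ.IsQIEmbedded μ₁ μ₂ (φ.inSkel (W.approxSet K))

/-- The set `𝕎` of immersed walls has the ladder overlap property with bound `B` (where `X̃¹` is
`δ`-hyperbolic): for any two distinct tunnels of `W̄` meeting a common knockout, the closed
`(3δ + 2λ)`-neighbourhoods of the carriers of their approximations intersect in a set of diameter
at most `B`. -/
def LadderOverlap (δ B : ℝ) (𝕎 : Set φ.ImmersedWall) : Prop :=
  ∀ W ∈ 𝕎, ∀ c : φ.VPoint, c.proj = W.point → ∀ K, W.IsKnockout c K →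
    ∀ τ₁ τ₂ : W.Root, τ₁ ≠ τ₂ → W.Meets τ₁ K → W.Meets τ₂ K →
      Metric.ediam
        (Metric.cthickening (3 * δ + 2 * φ.ladderConst) (W.tunnelCarrier τ₁) ∩
          Metric.cthickening (3 * δ + 2 * φ.ladderConst) (W.tunnelCarrier τ₂)) ≤ ENNReal.ofReal B

end GraphMap

end

/-- `p` lies metrically between `x` and `y`. -/
def MBtw {X : Type*} [PseudoMetricSpace X] (x p y : X) : Prop := dist x p + dist p y = dist x y

theorem MBtw.symm {X : Type*} [PseudoMetricSpace X] {x p y : X} (h : MBtw x p y) :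
    MBtw y p x := by
  unfold MBtw at *
  rw [dist_comm y p, dist_comm p x, dist_comm y x]; linarith

/-- A geodesic space all of whose geodesic triangles are `δ`-slim, in terms of betweenness. -/
structure IsSlim (X : Type*) [PseudoMetricSpace X] (δ : ℝ) : Prop where
  nonneg : 0 ≤ δ
  exists_btw : ∀ (x y : X) (t : ℝ), 0 ≤ t → t ≤ dist x y → ∃ p, MBtw x p y ∧ dist x p = t
  slim : ∀ ε > 0, ∀ x y z p : X, MBtw x p y →
    ∃ p', dist p p' ≤ δ + ε ∧ (MBtw x p' z ∨ MBtw z p' y)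

/-- `x` and `y` are joined by a `1`-Lipschitz path `[0, ℓ] → Y`. -/
def LipJoined {X : Type*} [PseudoMetricSpace X] (Y : Set X) (ℓ : ℝ) (x y : X) : Prop :=
  ∃ g : ℝ → X, g 0 = x ∧ g ℓ = y ∧ (∀ s ∈ Icc 0 ℓ, g s ∈ Y) ∧
    ∀ s ∈ Icc 0 ℓ, ∀ t ∈ Icc 0 ℓ, dist (g s) (g t) ≤ |s - t|

theorem LipJoined.concat {X : Type*} [PseudoMetricSpace X] {Y : Set X} {k r : ℝ} {x p y : X}
    (hk0 : 0 ≤ k) (hr0 : 0 ≤ r) (h : LipJoined Y k x p) (h' : LipJoined Y r p y) :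
    ∃ g : ℝ → X, g 0 = x ∧ g k = p ∧ g (k + r) = y ∧ (∀ s ∈ Icc 0 (k + r), g s ∈ Y) ∧
      ∀ s ∈ Icc 0 (k + r), ∀ t ∈ Icc 0 (k + r), dist (g s) (g t) ≤ |s - t| := by
  obtain ⟨f, hf0, hfk, hfY, hf⟩ := h
  obtain ⟨g, hg0, hg1, hgY, hg⟩ := h'
  refine ⟨fun u => if u ≤ k then f u else g (u - k), ?_, ?_, ?_, ?_, ?_⟩
  · simp [hk0, hf0]
  · simp [hfk]
  · by_cases h0 : r ≤ 0
    · have h00 : r = 0 := le_antisymm h0 hr0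
      simp only [h00, add_zero, le_refl, if_true, hfk]
      rw [← hg0, ← hg1, h00]
    · have : ¬ k + r ≤ k := by linarith
      simp only [this, if_false, add_sub_cancel_left, hg1]
  · intro u hu'
    by_cases h0 : u ≤ k
    · simp only [h0, if_true]
      exact hfY _ ⟨hu'.1, h0⟩
    · simp only [h0, if_false]
      rw [not_le] at h0
      exact hgY _ ⟨by linarith, by linarith [hu'.2]⟩
  · have main : ∀ u ∈ Icc 0 (k + r), ∀ v ∈ Icc 0 (k + r), u ≤ v →
        dist (if u ≤ k then f u else g (u - k)) (if v ≤ k then f v else g (v - k)) ≤ |u - v| := by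
      intro u h1 v h2 huv
      by_cases hv : v ≤ k
      · rw [if_pos (huv.trans hv), if_pos hv]
        exact hf u ⟨h1.1, huv.trans hv⟩ v ⟨h2.1, hv⟩
      · rw [if_neg hv]
        rw [not_le] at hv
        by_cases hu' : u ≤ k
        · rw [if_pos hu']
          have a1 := hf u ⟨h1.1, hu'⟩ k ⟨hk0, le_rfl⟩
          have a2 := hg 0 ⟨le_rfl, hr0⟩ (v - k) ⟨by linarith, by linarith [h2.2]⟩
          rw [hg0, ← hfk] at a2
          refine (dist_triangle _ (f k) _).trans ?_
          rw [abs_of_nonpos (by linarith)] at a1 a2 ⊢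
          linarith
        · rw [if_neg hu']
          rw [not_le] at hu'
          have := hg (u - k) ⟨by linarith, by linarith [h1.2]⟩ (v - k)
            ⟨by linarith, by linarith [h2.2]⟩
          rwa [sub_sub_sub_cancel_right] at this
    intro u h1 v h2
    rcases le_total u v with huv | huv
    · exact main u h1 v h2 huv
    · rw [dist_comm, abs_sub_comm]
      exact main v h2 u h1 huv

/-- Points between two points of `Y` are at distance at most `R` from `Y`. -/
def MQuasiconvex {X : Type*} [PseudoMetricSpace X] (R : ℝ) (Y : Set X) : Prop :=
  ∀ x ∈ Y, ∀ y ∈ Y, ∀ p, MBtw x p y → ∃ z ∈ Y, dist p z ≤ R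

/-- The Gromov product of `x` and `y` based at `o`. -/
noncomputable def gromovProd {X : Type*} [PseudoMetricSpace X] (o x y : X) : ℝ :=
  (dist o x + dist o y - dist x y) / 2

namespace IsSlim

variable {X : Type*} [PseudoMetricSpace X] {δ : ℝ}

theorem near_chain (h : IsSlim X δ) (n : ℕ) : ∀ f : ℕ → X,
    (∀ i < 2 ^ n, dist (f i) (f (i + 1)) ≤ 1) → ∀ p, MBtw (f 0) p (f (2 ^ n)) →
      ∃ i ≤ 2 ^ n, dist p (f i) ≤ n * (δ + 1) + 1 := by
  induction n with
  | zero =>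
    intro f hf p hp
    refine ⟨0, Nat.zero_le _, ?_⟩
    have h0 := hf 0 (by norm_num)
    unfold MBtw at hp
    rw [pow_zero] at hp
    have := dist_nonneg (x := p) (y := f 1)
    rw [dist_comm p]
    simp only [zero_add, Nat.cast_zero, zero_mul] at *
    linarith
  | succ n ih =>
    intro f hf p hp
    obtain ⟨p', hpp, hb⟩ := h.slim 1 one_pos _ _ (f (2 ^ n)) p hp
    have h2 : 2 ^ (n + 1) = 2 ^ n + 2 ^ n := by ring
    rcases hb with hb | hb
    · obtain ⟨i, hi, hd⟩ := ih f (fun i hi => hf i (by omega)) p' hb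
      refine ⟨i, by omega, ?_⟩
      have := dist_triangle p p' (f i)
      push_cast; linarith
    · obtain ⟨i, hi, hd⟩ := ih (fun j => f (2 ^ n + j))
        (fun i hi => hf (2 ^ n + i) (by omega)) p' (by simpa [← h2] using hb)
      refine ⟨2 ^ n + i, by omega, ?_⟩
      have := dist_triangle p p' (f (2 ^ n + i))
      push_cast; linarith

theorem near_lipJoined (h : IsSlim X δ) {Y : Set X} {ℓ : ℝ} {x y p : X} (hℓ : 0 ≤ ℓ)
    (hj : LipJoined Y ℓ x y) (n : ℕ) (hn : ℓ ≤ 2 ^ n) (hp : MBtw x p y) :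
    ∃ z ∈ Y, dist p z ≤ n * (δ + 1) + 1 := by
  obtain ⟨g, rfl, rfl, hgY, hg⟩ := hj
  have h2 : (0 : ℝ) < 2 ^ n := by positivity
  have hmem : ∀ i : ℕ, i ≤ 2 ^ n → (i : ℝ) * (ℓ / 2 ^ n) ∈ Icc 0 ℓ := by
    intro i hi
    refine ⟨by positivity, ?_⟩
    have : (i : ℝ) ≤ 2 ^ n := by exact_mod_cast hi
    calc (i : ℝ) * (ℓ / 2 ^ n) ≤ 2 ^ n * (ℓ / 2 ^ n) := by gcongr
      _ = ℓ := by field_simp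
  obtain ⟨i, hi, hd⟩ := h.near_chain n (fun i : ℕ => g (i * (ℓ / 2 ^ n))) (by
    intro i hi
    refine (hg _ (hmem i hi.le) _ (hmem (i + 1) hi)).trans ?_
    have : (i : ℝ) * (ℓ / 2 ^ n) - ((i + 1 : ℕ) : ℝ) * (ℓ / 2 ^ n) = - (ℓ / 2 ^ n) := by
      push_cast; ring
    rw [this, abs_neg, abs_of_nonneg (by positivity)]
    exact (div_le_one h2).2 hn) p (by
      have : ((2 ^ n : ℕ) : ℝ) * (ℓ / 2 ^ n) = ℓ := by push_cast; field_simp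
      simp only [this, Nat.cast_zero, zero_mul]; exact hp)
  exact ⟨_, hgY _ (hmem i hi), hd⟩

theorem exists_log_bound (a b η k : ℝ) (ha : 0 ≤ a) :
    ∃ R, 0 ≤ R ∧ ∀ S : ℝ, (∀ n : ℕ, a * S + b ≤ 2 ^ n → S ≤ n * η + k) → S ≤ R := by
  have key : ∀ᶠ n : ℕ in Filter.atTop, a * ((n + 1 : ℕ) * η + k) + b ≤ 2 ^ n := by
    have h1 : Filter.Tendsto (fun n : ℕ => (n : ℝ) ^ 1 / (2 : ℝ) ^ n) Filter.atTop (nhds 0) :=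
      tendsto_pow_const_div_const_pow_of_one_lt 1 one_lt_two
    have h2 : Filter.Tendsto (fun n : ℕ => (1 : ℝ) / (2 : ℝ) ^ n) Filter.atTop (nhds 0) := by
      simpa using tendsto_pow_const_div_const_pow_of_one_lt 0 (one_lt_two (α := ℝ))
    have h3 := (h1.const_mul (a * η)).add (h2.const_mul (a * (η + k) + b))
    rw [mul_zero, mul_zero, add_zero] at h3
    filter_upwards [h3.eventually_lt_const one_pos] with n hn
    have hp : (0 : ℝ) < 2 ^ n := by positivity
    have hn' : a * η * ((n : ℝ) ^ 1 / 2 ^ n) + (a * (η + k) + b) * (1 / 2 ^ n) < 1 := hn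
    have : (a * η * n + (a * (η + k) + b)) / 2 ^ n < 1 := by
      rw [pow_one] at hn'
      rwa [add_div, mul_div_assoc, div_eq_mul_one_div (a * (η + k) + b)]
    rw [div_lt_one hp] at this
    push_cast; linarith
  obtain ⟨N, hN⟩ := Filter.eventually_atTop.1 key
  refine ⟨max 0 (N * η + k), le_max_left _ _, fun S hS => ?_⟩
  by_cases h0 : a * S + b ≤ 2 ^ N
  · exact (hS N h0).trans (le_max_right _ _)
  exfalso
  have hex : ∃ n : ℕ, a * S + b ≤ 2 ^ n := by
    obtain ⟨n, hn⟩ := pow_unbounded_of_one_lt (a * S + b) (one_lt_two (α := ℝ))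
    exact ⟨n, hn.le⟩
  classical
  have hs := Nat.find_spec hex
  have hm := fun m => Nat.find_min hex (m := m)
  generalize Nat.find hex = n at hs hm
  have hn : N < n := by
    by_contra hc
    exact h0 (hs.trans (pow_le_pow_right₀ one_le_two (not_lt.1 hc)))
  obtain ⟨m, rfl⟩ : ∃ m, n = m + 1 := ⟨n - 1, by omega⟩
  refine hm m (by omega) ?_
  have h1 := hS _ hs
  have h2 := hN m (by omega)
  have := mul_le_mul_of_nonneg_left h1 ha
  linarith

theorem btw_trans {x p y q : X} (hp : MBtw x p y) (hq : MBtw x q p) :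
    MBtw x q y ∧ MBtw q p y := by
  unfold MBtw at *
  have := dist_triangle x q y
  have := dist_triangle q p y
  constructor <;> linarith

/-- Sets whose points are joined inside the set by paths of length bounded linearly in the distance
are uniformly quasiconvex. -/
theorem exists_quasiconvex (h : IsSlim X δ) (c : ℝ) : ∃ R, 0 ≤ R ∧ ∀ Y : Set X,
    (∀ x ∈ Y, ∀ y ∈ Y, ∃ ℓ, 0 ≤ ℓ ∧ ℓ ≤ c * (dist x y + 1) ∧ LipJoined Y ℓ x y) →
      MQuasiconvex R Y := by
  have hδ := h.nonneg
  set c' := max c 0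
  have hc' : 0 ≤ c' := le_max_right _ _
  obtain ⟨R, hR0, hR⟩ := exists_log_bound (c' * 6) (c' * 7) (δ + 1) (4 * δ + 6) (by positivity)
  refine ⟨R + 1, by positivity, fun Y hY x hx y hy => ?_⟩
  have hYne : Y.Nonempty := ⟨x, hx⟩
  set A : Set ℝ := {r | ∃ p, MBtw x p y ∧ r = Metric.infDist p Y} with hA
  have hAb : BddAbove A := by
    refine ⟨dist x y, ?_⟩
    rintro r ⟨p, hp, rfl⟩
    have := Metric.infDist_le_dist_of_mem (x := p) hx
    unfold MBtw at hp
    have := dist_nonneg (x := p) (y := y)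
    rw [dist_comm p x] at *
    linarith
  have hAx : (0 : ℝ) ∈ A := ⟨x, by simp [MBtw], (Metric.infDist_zero_of_mem hx).symm⟩
  set S := sSup A with hS
  have hS0 : 0 ≤ S := le_csSup hAb hAx
  have hSle : ∀ p, MBtw x p y → Metric.infDist p Y ≤ S := fun p hp => le_csSup hAb ⟨p, hp, rfl⟩
  have near : ∀ p, MBtw x p y → ∃ z ∈ Y, dist p z ≤ S + 1 := by
    intro p hp
    obtain ⟨z, hz, hd⟩ := (Metric.infDist_lt_iff hYne).1 ((hSle p hp).trans_lt (lt_add_one S))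
    exact ⟨z, hz, hd.le⟩
  suffices hSR : S ≤ R by
    intro p hp
    obtain ⟨z, hz, hd⟩ := near p hp
    exact ⟨z, hz, by linarith⟩
  apply hR
  intro n hn
  obtain ⟨_, ⟨p, hp, rfl⟩, hpS⟩ := exists_lt_of_lt_csSup ⟨0, hAx⟩ (sub_one_lt S)
  have hpY : ∀ z ∈ Y, S - 1 < dist p z := fun z hz =>
    hpS.trans_le (Metric.infDist_le_dist_of_mem hz)
  -- a point towards an end `x'` of the geodesic
  have side : ∀ x' y' : X, x' ∈ Y → MBtw x' p y' → (∀ q, MBtw x' q y' → ∃ z ∈ Y, dist q z ≤ S + 1) →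
      ∃ q z, MBtw x' q p ∧ z ∈ Y ∧ dist q p ≤ 2 * S + 2 ∧ dist q z ≤ S + 1 ∧
        ∀ w, MBtw q w z → S - 1 ≤ dist p w := by
    intro x' y' hx' hp' hnear
    by_cases hc : dist x' p ≤ 2 * S + 2
    · refine ⟨x', x', by simp [MBtw], hx', hc, by simp; linarith, fun w hw => ?_⟩
      have h1 : dist x' w = 0 := by
        have h2 := dist_nonneg (x := x') (y := w)
        have h3 := dist_nonneg (x := w) (y := x')
        unfold MBtw at hw
        rw [dist_self] at hw; linarith
      have := hpY x' hx'
      have := dist_triangle p w x'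
      rw [dist_comm w x'] at this
      linarith
    · obtain ⟨q, hq, hqd⟩ := h.exists_btw x' p (dist x' p - (2 * S + 2)) (by linarith) (by linarith)
      have hqp : dist q p = 2 * S + 2 := by unfold MBtw at hq; linarith
      obtain ⟨z, hz, hd⟩ := hnear q (btw_trans hp' hq).1
      refine ⟨q, z, hq, hz, hqp.le, hd, fun w hw => ?_⟩
      unfold MBtw at hw
      have := dist_triangle q w p
      have := dist_nonneg (x := w) (y := z)
      rw [dist_comm p w]
      linarith
  obtain ⟨q₁, z₁, hq₁, hz₁, hd₁, he₁, hf₁⟩ := side x y hx hp near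
  obtain ⟨q₂, z₂, hq₂, hz₂, hd₂, he₂, hf₂⟩ := side y x hy hp.symm fun q hq => near q hq.symm
  have hb : MBtw q₁ p q₂ := by
    have h1 := (btw_trans hp hq₁).2
    have h2 := (btw_trans h1.symm hq₂).2
    exact h2.symm
  obtain ⟨p₁, hp₁, hb₁⟩ := h.slim 1 one_pos _ _ z₁ p hb
  obtain ⟨ℓ, hℓ0, hℓ, hj⟩ := hY z₁ hz₁ z₂ hz₂
  have hnη : 0 ≤ (n : ℝ) * (δ + 1) := by positivity
  rcases hb₁ with hb₁ | hb₁
  · have := hf₁ p₁ hb₁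
    linarith
  obtain ⟨p₂, hp₂, hb₂⟩ := h.slim 1 one_pos _ _ z₂ p₁ hb₁
  have ht := dist_triangle p p₁ p₂
  rcases hb₂ with hb₂ | hb₂
  · have hzz : dist z₁ z₂ ≤ 6 * S + 6 := by
      have h1 := dist_triangle z₁ q₁ z₂
      have h2 := dist_triangle q₁ p z₂
      have h3 := dist_triangle p q₂ z₂
      rw [dist_comm z₁ q₁] at h1
      rw [dist_comm p q₂] at h3
      linarith
    have hℓn : ℓ ≤ 2 ^ n := by
      have h1 : c * (dist z₁ z₂ + 1) ≤ c' * (dist z₁ z₂ + 1) := by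
        gcongr; exact le_max_left _ _
      have h2 : c' * (dist z₁ z₂ + 1) ≤ c' * (6 * S + 7) := by
        apply mul_le_mul_of_nonneg_left _ hc'; linarith
      linarith
    obtain ⟨z, hz, hd⟩ := h.near_lipJoined hℓ0 hj n hℓn hb₂
    have h1 := hpY z hz
    have h2 := dist_triangle p p₂ z
    linarith
  · have := hf₂ p₂ hb₂.symm
    linarith

/-! ### Gromov products -/

theorem gromovProd_le {o x y p : X} (hp : MBtw x p y) : gromovProd o x y ≤ dist o p := by
  unfold gromovProd MBtw at *
  have h1 := dist_triangle o p x
  have h2 := dist_triangle o p y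
  rw [dist_comm p x] at h1
  linarith

theorem exists_btw_dist_le (h : IsSlim X δ) (o x y : X) :
    ∃ p, MBtw x p y ∧ dist o p ≤ gromovProd o x y + 2 * (δ + 1) := by
  have t1 := dist_triangle o x y
  have t2 := dist_triangle x o y
  have t3 := dist_triangle o y x
  have hxo := dist_comm x o
  have hyx := dist_comm y x
  obtain ⟨p, hp, hpd⟩ := h.exists_btw x y (gromovProd x o y) (by unfold gromovProd; linarith)
    (by unfold gromovProd; linarith)
  refine ⟨p, hp, ?_⟩
  obtain ⟨p', hd, hb⟩ := h.slim 1 one_pos _ _ o p hp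
  unfold gromovProd MBtw at *
  have hop := dist_triangle o p' p
  rw [dist_comm p' p] at hop
  rcases hb with hb | hb
  · have := dist_triangle x p' p
    rw [dist_comm p' p] at this
    rw [dist_comm p' o] at hb
    linarith
  · have := dist_triangle y p' p
    rw [dist_comm p' p, dist_comm y p', dist_comm y p] at this
    linarith

theorem four_point (h : IsSlim X δ) (o x y z : X) :
    min (gromovProd o x y) (gromovProd o y z) ≤ gromovProd o x z + 3 * (δ + 1) := by
  obtain ⟨p, hp, hpd⟩ := h.exists_btw_dist_le o x z
  obtain ⟨p', hd, hb⟩ := h.slim 1 one_pos _ _ y p hp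
  have := dist_triangle o p p'
  rcases hb with hb | hb
  · exact (min_le_left _ _).trans (by linarith [gromovProd_le (o := o) hb])
  · exact (min_le_right _ _).trans (by linarith [gromovProd_le (o := o) hb])

/-- Two geodesics issuing from `o` stay close up to the Gromov product of their endpoints. -/
theorem fellow (h : IsSlim X δ) {o a b z : X} (hz : MBtw o z a) {ε : ℝ} (hε : 0 < ε)
    (hlt : dist o z < gromovProd o a b - (δ + ε)) : ∃ z', dist z z' ≤ δ + ε ∧ MBtw o z' b := by
  obtain ⟨z', hd, hb⟩ := h.slim ε hε _ _ b z hz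
  refine ⟨z', hd, hb.resolve_right fun hb => ?_⟩
  have h1 := gromovProd_le (o := o) hb.symm
  have := dist_triangle o z z'
  linarith

/-- The parts of a broken path `a, o, b` are nearly aligned, if `o` and `a` lie in a set `T` in which
distances to `o` are controlled by the height, and `o` and `b` lie in a set `K` of constant height. -/
theorem exists_gromovProd_le (h : IsSlim X δ) (ht : X → ℝ)
    (hht : ∀ x y, |ht x - ht y| ≤ dist x y) (c R : ℝ) :
    ∃ C, 0 ≤ C ∧ ∀ (T K : Set X) (o : X) (k : ℝ), MQuasiconvex R T → MQuasiconvex R K →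
      (∀ z ∈ T, dist z o ≤ c * (|ht z - k| + 1)) → (∀ z ∈ K, ht z = k) → o ∈ T → o ∈ K →
        ∀ a ∈ T, ∀ b ∈ K, gromovProd o a b ≤ C := by
  have hδ := h.nonneg
  set c' := max c 0
  have hc' : 0 ≤ c' := le_max_right _ _
  set R' := max R 0
  have hR' : 0 ≤ R' := le_max_right _ _
  refine ⟨c' * (R' + (δ + 1) + R' + 1) + R' + (δ + 1) + 1, by positivity, ?_⟩
  intro T K o k hT hK hTo hKk hoT hoK a ha b hb
  by_contra! hgt
  set C := c' * (R' + (δ + 1) + R' + 1) + R' with hC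
  have hC0 : 0 ≤ C := by positivity
  have hga : gromovProd o a b ≤ dist o a := gromovProd_le (p := a) (by simp [MBtw])
  obtain ⟨z, hz, hzd⟩ := h.exists_btw o a (gromovProd o a b - (δ + 1) - 1 / 2) (by linarith)
    (by linarith)
  obtain ⟨z', hd, hz'⟩ := h.fellow hz one_pos (b := b) (by linarith)
  obtain ⟨t, htT, htd⟩ := hT o hoT a ha z hz
  obtain ⟨s, hsK, hsd⟩ := hK o hoK b hb z' hz'
  have hR1 : R ≤ R' := le_max_left _ _
  have h1 := hTo t htT
  have h2 : |ht t - k| ≤ R' + (δ + 1) + R' := by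
    rw [← hKk s hsK]
    refine (hht t s).trans ?_
    have e1 := dist_triangle t z s
    have e2 := dist_triangle z z' s
    rw [dist_comm t z] at e1
    linarith
  have h3 : c * (|ht t - k| + 1) ≤ c' * (R' + (δ + 1) + R' + 1) := by
    have : 0 ≤ |ht t - k| + 1 := by positivity
    calc c * (|ht t - k| + 1) ≤ c' * (|ht t - k| + 1) := by gcongr; exact le_max_left _ _
      _ ≤ _ := by gcongr
  have h4 := dist_triangle o t z
  rw [dist_comm o t, dist_comm t z] at h4
  linarith

theorem _root_.mem_cthickening_of_forall_dist_le {r : ℝ} {z : X} {T : Set X}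
    (h : ∀ ε, 0 < ε → ε < 1 / 4 → ∃ t ∈ T, dist z t ≤ r + 3 * ε) : z ∈ Metric.cthickening r T := by
  rw [Metric.cthickening_eq_iInter_cthickening]
  simp only [mem_iInter]
  intro s hs
  obtain ⟨t, ht, hd⟩ := h (min ((s - r) / 3) (1 / 8)) (by positivity [sub_pos.2 hs])
    (by linarith [min_le_right ((s - r) / 3) (1 / 8 : ℝ)])
  exact Metric.mem_cthickening_of_dist_le _ _ _ _ ht
    (by linarith [min_le_left ((s - r) / 3) (1 / 8 : ℝ)])

/-- The broken path `a, o, o', b` is nearly aligned, if `o` and `a` lie in `T`, `o'` and `b` lie in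
`T'`, and `o` and `o'` lie in `K`, where the neighbourhoods of `T` and `T'` have bounded overlap. -/
theorem exists_aligned (h : IsSlim X δ) (ht : X → ℝ)
    (hht : ∀ x y, |ht x - ht y| ≤ dist x y) (c R lam B : ℝ) (hlam : 0 ≤ lam) (hB : 0 ≤ B) :
    ∃ C, 0 ≤ C ∧ ∀ (T T' K : Set X) (o o' : X) (k : ℝ), MQuasiconvex R T → MQuasiconvex R T' →
      MQuasiconvex R K → (∀ r > lam, MQuasiconvex r T) → (∀ r > lam, MQuasiconvex r T') →
      (∀ z ∈ T, dist z o ≤ c * (|ht z - k| + 1)) →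
      (∀ z ∈ T', dist z o' ≤ c * (|ht z - k| + 1)) → (∀ z ∈ K, ht z = k) →
      o ∈ T → o ∈ K → o' ∈ T' → o' ∈ K →
      (∀ z w, z ∈ Metric.cthickening (3 * δ + 2 * lam) T →
        z ∈ Metric.cthickening (3 * δ + 2 * lam) T' →
        w ∈ Metric.cthickening (3 * δ + 2 * lam) T →
        w ∈ Metric.cthickening (3 * δ + 2 * lam) T' → dist z w ≤ B) →
        ∀ a ∈ T, ∀ b ∈ T', dist a o + dist o o' + dist o' b ≤ dist a b + C := by
  have hδ := h.nonneg
  obtain ⟨C₁, hC₁, key⟩ := h.exists_gromovProd_le ht hht c R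
  refine ⟨2 * (B + (2 * C₁ + 3 * (δ + 1)) + 3 * δ + 3) + 2 * (2 * C₁ + 3 * (δ + 1)), by positivity,
    ?_⟩
  intro T T' K o o' k hT hT' hK hTl hTl' hTo hTo' hKk hoT hoK hoT' hoK' hov a ha b hb
  have g₁ := key T K o k hT hK hTo hKk hoT hoK a ha o' hoK'
  have g₂ := key T' K o' k hT' hK hTo' hKk hoT' hoK' b hb o hoK
  have hoo := dist_comm o' o
  have hao := dist_comm a o
  have hbo := dist_comm b o
  have hbo' := dist_comm b o'
  by_cases hM : 2 * C₁ + 3 * (δ + 1) < dist o o'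
  · have h4 := h.four_point o a b o'
    have hg : gromovProd o a b ≤ C₁ + 3 * (δ + 1) := by
      rcases min_le_iff.1 h4 with h5 | h5
      · linarith
      · unfold gromovProd at *; linarith
    unfold gromovProd at *
    linarith
  · rw [not_lt] at hM
    have hg : gromovProd o a b ≤ B + (2 * C₁ + 3 * (δ + 1)) + 3 * δ + 3 := by
      by_contra! hgt
      have hga : gromovProd o a b ≤ dist o a := gromovProd_le (p := a) (by simp [MBtw])
      have near : ∀ z, MBtw o z a → 2 * C₁ + 3 * (δ + 1) + 2 * δ + 1 ≤ dist o z →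
          dist o z ≤ gromovProd o a b - δ - 1 →
          z ∈ Metric.cthickening (3 * δ + 2 * lam) T ∧
            z ∈ Metric.cthickening (3 * δ + 2 * lam) T' := by
        intro z hz hz1 hz2
        constructor
        · refine mem_cthickening_of_forall_dist_le fun ε hε _ => ?_
          obtain ⟨t, htT, htd⟩ := hTl (lam + ε) (by linarith) o hoT a ha z hz
          exact ⟨t, htT, by linarith⟩
        · refine mem_cthickening_of_forall_dist_le fun ε hε hε' => ?_
          obtain ⟨z', hd, hz'⟩ := h.fellow hz hε (b := b) (by linarith)
          obtain ⟨z'', hd', hb'⟩ := h.slim ε hε _ _ o' z' hz'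
          have e1 := dist_triangle z z' z''
          rcases hb' with hb' | hb'
          · exfalso
            have e2 := dist_triangle o z'' z
            have e3 : dist o z'' ≤ dist o o' := by
              unfold MBtw at hb'
              have := dist_nonneg (x := z'') (y := o'); linarith
            rw [dist_comm z'' z] at e2
            linarith
          · obtain ⟨t, htT, htd⟩ := hTl' (lam + ε) (by linarith) o' hoT' b hb z'' hb'
            have := dist_triangle z z'' t
            exact ⟨t, htT, by linarith⟩
      obtain ⟨z, hz, hzd⟩ := h.exists_btw o a (2 * C₁ + 3 * (δ + 1) + 2 * δ + 1) (by positivity)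
        (by linarith)
      obtain ⟨w, hw, hwd⟩ := h.exists_btw o a (gromovProd o a b - δ - 1) (by linarith)
        (by linarith)
      have nz := near z hz hzd.ge (by linarith)
      have nw := near w hw (by linarith) hwd.le
      have := hov z w nz.1 nz.2 nw.1 nw.2
      have := dist_triangle o z w
      linarith
    have t1 := dist_triangle o' o b
    unfold gromovProd at *
    linarith

/-- Extending a broken path whose last segment `m, o` is long. -/
theorem aligned_step (h : IsSlim X δ) {C L : ℝ} (hL : 2 * C + 6 * (δ + 1) < L) {x m o o' b : X}
    (hC : 0 ≤ C) (hx : gromovProd m x o ≤ C + 3 * (δ + 1)) (hmo : L ≤ dist m o)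
    (hb : dist m o + dist o o' + dist o' b ≤ dist m b + C) :
    dist x o + dist o o' + dist o' b ≤ dist x b + (2 * C + 6 * (δ + 1)) := by
  have h4 := h.four_point o m x b
  have t1 := dist_triangle o o' b
  have t2 := dist_triangle m o b
  have e1 := dist_comm o m
  have e2 := dist_comm x o
  have e3 := dist_comm x m
  have hδ := h.nonneg
  rcases min_le_iff.1 h4 with h5 | h5 <;> unfold gromovProd at * <;> linarith

theorem gromovProd_le_of_aligned {C : ℝ} {x o o' b : X}
    (hb : dist x o + dist o o' + dist o' b ≤ dist x b + 2 * C) : gromovProd o' x b ≤ C := by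
  have t1 := dist_triangle x o o'
  have e3 := dist_comm x o'
  unfold gromovProd
  linarith

end IsSlim

namespace GraphMap

variable {V E : Type*} {φ : GraphMap V E}

/-! ### Vertices and edges of the universal cover -/

theorem Fiber.traverse_traverse {a b c : V} (u : φ.Fiber a) (p q : List ((E ⊕ V) × Bool))
    (hp : φ.torusGraph.IsWalk a p b) (hq : φ.torusGraph.IsWalk b q c) :
    (u.traverse p hp).traverse q hq = u.traverse (p ++ q) (hp.append _ hq) := by
  induction u using Quot.ind with
  | mk r =>
    simp only [Fiber.traverse, Quot.map]
    congr 1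
    simp [List.append_assoc]

theorem Fiber.traverse_nil {a : V} (u : φ.Fiber a) (h : φ.torusGraph.IsWalk a [] a) :
    u.traverse [] h = u := by
  induction u using Quot.ind with
  | mk r => exact congrArg (Quot.mk _) (Subtype.ext (List.append_nil _))

theorem Fiber.traverse_backtrack {a b : V} (u : φ.Fiber a) (c : E ⊕ V) (s : Bool)
    (h₁ : φ.torusGraph.IsWalk a [(c, s)] b) (h₂ : φ.torusGraph.IsWalk b [(c, !s)] a) :
    (u.traverse [(c, s)] h₁).traverse [(c, !s)] h₂ = u := by
  induction u using Quot.ind with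
  | mk r =>
    apply Quot.sound
    have := ElemHomotopy.backtrack (φ := φ) r.1 [] c s
    simpa using this

variable (φ) in
/-- The vertices of the universal cover. -/
abbrev Vtx := Σ w, φ.Fiber w

/-- A vertex, as a point of the 1-skeleton. -/
def Vtx.toSkel (u : φ.Vtx) : φ.Skel := (VPoint.vertex u.2).toSkel

/-- The initial vertex of an edge of the universal cover. -/
def edgeStart : φ.CoverEdge → φ.Vtx
  | .inl e => ⟨_, e.start⟩
  | .inr u => u

/-- The terminal vertex of an edge of the universal cover. -/
def edgeFinish : φ.CoverEdge → φ.Vtx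
  | .inl e => ⟨_, e.finish⟩
  | .inr u => ⟨_, u.2.shift⟩

@[simp] theorem LiftEdge.pt_zero (e : φ.LiftEdge) : e.pt 0 = .vertex e.start := by
  simp [LiftEdge.pt]

@[simp] theorem LiftEdge.pt_one (e : φ.LiftEdge) : e.pt 1 = .vertex e.finish := by
  simp [LiftEdge.pt, not_le.2 one_pos]

theorem LiftEdge.pt_inner (e : φ.LiftEdge) (s : Ioo (0 : ℝ) 1) : e.pt s = .inner e s := by
  obtain ⟨s, hs⟩ := s
  simp [LiftEdge.pt, hs.1, hs.2]

theorem Skel.ext {x y : φ.Skel} (h : x.1 = y.1) : x = y := Subtype.ext h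

theorem edgePt_inr_val (u : φ.Vtx) {s : ℝ} (hs : s ∈ Ico (0 : ℝ) 1) :
    (φ.edgePt (.inr u) s).1 = (.vertex u.2, ⟨s, hs⟩) := by
  obtain ⟨w, u⟩ := u
  exact congrArg Subtype.val (dif_pos hs : φ.edgePt (.inr ⟨w, u⟩) s = _)

theorem edgePt_inl_val (e : φ.LiftEdge) (s : Ioo (0 : ℝ) 1) :
    (φ.edgePt (.inl e) s).1 = (.inner e s, ⟨0, le_rfl, one_pos⟩) := by
  rw [edgePt, LiftEdge.pt_inner]; rfl

theorem edgePt_zero (c : φ.CoverEdge) : φ.edgePt c 0 = (edgeStart c).toSkel := by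
  rcases c with e | u
  · simp [edgePt, edgeStart, Vtx.toSkel]
  · exact Skel.ext (edgePt_inr_val u ⟨le_rfl, one_pos⟩)

theorem edgePt_one (c : φ.CoverEdge) : φ.edgePt c 1 = (edgeFinish c).toSkel := by
  rcases c with e | ⟨w, u⟩
  · simp [edgePt, edgeFinish, Vtx.toSkel]
  · simp [edgePt, edgeFinish, Vtx.toSkel]

theorem Vtx.toSkel_val (u : φ.Vtx) : u.toSkel.1 = (.vertex u.2, ⟨0, le_rfl, one_pos⟩) := rfl

theorem edgePt_interior_ne_vertex {c : φ.CoverEdge} {s : ℝ} (hs : s ∈ Ioo (0 : ℝ) 1)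
    (u : φ.Vtx) : φ.edgePt c s ≠ u.toSkel := by
  intro h
  have h := congrArg Subtype.val h
  rw [Vtx.toSkel_val] at h
  rcases c with e | v
  · rw [edgePt_inl_val e ⟨s, hs⟩] at h
    cases congrArg Prod.fst h
  · rw [edgePt_inr_val v ⟨hs.1.le, hs.2⟩] at h
    exact hs.1.ne' (congrArg (fun z => z.2.1) h)

/-- Interior points of edges determine the edge. -/
theorem edgePt_interior {c c' : φ.CoverEdge} {s t : ℝ} (hs : s ∈ Ioo (0 : ℝ) 1)
    (ht : t ∈ Icc (0 : ℝ) 1) (h : φ.edgePt c s = φ.edgePt c' t) : c = c' ∧ s = t := by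
  rcases ht.1.eq_or_lt with rfl | ht0
  · exact absurd (h.trans (edgePt_zero c')) (edgePt_interior_ne_vertex hs _)
  rcases ht.2.eq_or_lt with rfl | ht1
  · exact absurd (h.trans (edgePt_one c')) (edgePt_interior_ne_vertex hs _)
  have h := congrArg Subtype.val h
  rcases c with e | u <;> rcases c' with e' | u'
  · rw [edgePt_inl_val e ⟨s, hs⟩, edgePt_inl_val e' ⟨t, ht0, ht1⟩] at h
    have h := congrArg Prod.fst h
    simp only [VPoint.inner.injEq] at h
    exact ⟨congrArg _ h.1, Subtype.ext_iff.1 h.2⟩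
  · rw [edgePt_inl_val e ⟨s, hs⟩, edgePt_inr_val u' ⟨ht0.le, ht1⟩] at h
    cases congrArg Prod.fst h
  · rw [edgePt_inl_val e' ⟨t, ht0, ht1⟩, edgePt_inr_val u ⟨hs.1.le, hs.2⟩] at h
    cases congrArg Prod.fst h
  · rw [edgePt_inr_val u ⟨hs.1.le, hs.2⟩, edgePt_inr_val u' ⟨ht0.le, ht1⟩] at h
    have h1 := congrArg Prod.fst h
    have h2 : s = t := congrArg (fun z => z.2.1) h
    obtain ⟨w, u⟩ := u
    obtain ⟨w', u'⟩ := u'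
    simp only [VPoint.vertex.injEq] at h1
    obtain ⟨rfl, h1⟩ := h1
    obtain rfl := eq_of_heq h1
    exact ⟨rfl, h2⟩

theorem exists_edgePt (x : φ.Skel) : ∃ c, ∃ s ∈ Icc (0 : ℝ) 1, φ.edgePt c s = x := by
  obtain ⟨⟨x, h⟩, hx⟩ := x
  cases x with
  | vertex u =>
    exact ⟨.inr ⟨_, u⟩, h, ⟨h.2.1, h.2.2.le⟩, Skel.ext (edgePt_inr_val ⟨_, u⟩ h.2)⟩
  | inner e s =>
    obtain rfl : h = ⟨0, le_rfl, one_pos⟩ := by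
      rcases hx with hx | ⟨w, u, hx⟩
      · exact Subtype.ext hx
      · cases hx
    exact ⟨.inl e, s, ⟨s.2.1.le, s.2.2.le⟩, Skel.ext (edgePt_inl_val e s)⟩

theorem edgeLen_pos (c : φ.CoverEdge) : 0 < φ.edgeLen c := by
  rcases c with e | u
  · exact φ.len_pos _
  · exact one_pos

/-! ### Paths -/

theorem PathIn.mono {Y Z : Set φ.Skel} (hYZ : Y ⊆ Z) {x y : φ.Skel} {ℓ : ℝ≥0∞}
    (h : φ.PathIn Y x y ℓ) : φ.PathIn Z x y ℓ := by
  induction h with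
  | refl x hx => exact .refl x (hYZ hx)
  | cons c s t hs ht hY y ℓ _ ih => exact .cons c s t hs ht (fun r hr => hYZ (hY r hr)) y ℓ ih

theorem PathIn.ne_top {Y : Set φ.Skel} {x y : φ.Skel} {ℓ : ℝ≥0∞}
    (h : φ.PathIn Y x y ℓ) : ℓ ≠ ∞ := by
  induction h with
  | refl x hx => exact ENNReal.zero_ne_top
  | cons c s t hs ht hY y ℓ _ ih => exact ENNReal.add_ne_top.2 ⟨ENNReal.ofReal_ne_top, ih⟩

theorem pathDist_mono {Y Z : Set φ.Skel} (hYZ : Y ⊆ Z) (x y : φ.Skel) :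
    φ.pathDist Z x y ≤ φ.pathDist Y x y :=
  le_iInf₂ fun _ h => iInf₂_le _ (h.mono hYZ)

theorem edist_le_pathDist (Y : Set φ.Skel) (x y : φ.Skel) : edist x y ≤ φ.pathDist Y x y :=
  pathDist_mono (subset_univ Y) x y

theorem PathIn.edge {Y : Set φ.Skel} (c : φ.CoverEdge) {s t : ℝ} (hs : s ∈ Icc (0 : ℝ) 1)
    (ht : t ∈ Icc (0 : ℝ) 1) (hY : ∀ r ∈ uIcc s t, φ.edgePt c r ∈ Y) :
    φ.PathIn Y (φ.edgePt c s) (φ.edgePt c t) (ENNReal.ofReal (|s - t| * φ.edgeLen c)) := by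
  simpa using PathIn.cons c s t hs ht hY _ _ (.refl _ (hY t right_mem_uIcc))

theorem PathIn.fullEdge {Y : Set φ.Skel} (c : φ.CoverEdge)
    (hY : ∀ r ∈ Icc (0 : ℝ) 1, φ.edgePt c r ∈ Y) :
    φ.PathIn Y (edgeStart c).toSkel (edgeFinish c).toSkel (ENNReal.ofReal (φ.edgeLen c)) := by
  have := PathIn.edge (Y := Y) c (s := 0) (t := 1) ⟨le_rfl, zero_le_one⟩ ⟨zero_le_one, le_rfl⟩
    (by rwa [uIcc_of_le zero_le_one])
  simpa [edgePt_zero, edgePt_one] using this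

theorem edgeFinish_back_inl (e : E) (u : φ.Fiber (φ.tgt e)) :
    edgeFinish (.inl ⟨e, u.traverse [(Sum.inl e, false)] ⟨rfl, rfl⟩⟩) = (⟨_, u⟩ : φ.Vtx) :=
  Sigma.ext rfl (heq_of_eq (u.traverse_backtrack (Sum.inl e) false ⟨rfl, rfl⟩ ⟨rfl, rfl⟩))

theorem edgeFinish_back_inr (w : V) (u : φ.Fiber (φ.mapV w)) :
    edgeFinish (.inr ⟨w, u.traverse [(Sum.inr w, false)] ⟨rfl, rfl⟩⟩) = (⟨_, u⟩ : φ.Vtx) :=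
  Sigma.ext rfl (heq_of_eq (u.traverse_backtrack (Sum.inr w) false ⟨rfl, rfl⟩ ⟨rfl, rfl⟩))

theorem exists_pathIn_back_inl (e : E) (u : φ.Fiber (φ.tgt e)) :
    ∃ ℓ, φ.PathIn univ (Vtx.toSkel ⟨_, u⟩)
      (Vtx.toSkel ⟨_, u.traverse [(Sum.inl e, false)] ⟨rfl, rfl⟩⟩) ℓ := by
  rw [← edgeFinish_back_inl]
  exact ⟨_, (PathIn.fullEdge (φ := φ) (Y := univ)
    (.inl ⟨e, u.traverse [(Sum.inl e, false)] ⟨rfl, rfl⟩⟩) fun _ _ => trivial).symm⟩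

theorem exists_pathIn_back_inr (w : V) (u : φ.Fiber (φ.mapV w)) :
    ∃ ℓ, φ.PathIn univ (Vtx.toSkel ⟨_, u⟩)
      (Vtx.toSkel ⟨_, u.traverse [(Sum.inr w, false)] ⟨rfl, rfl⟩⟩) ℓ := by
  rw [← edgeFinish_back_inr]
  exact ⟨_, (PathIn.fullEdge (φ := φ) (Y := univ)
    (.inr ⟨w, u.traverse [(Sum.inr w, false)] ⟨rfl, rfl⟩⟩) fun _ _ => trivial).symm⟩

theorem exists_pathIn_traverse {a b : V} (u : φ.Fiber a) (p : List ((E ⊕ V) × Bool))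
    (hp : φ.torusGraph.IsWalk a p b) :
    ∃ ℓ, φ.PathIn univ (Vtx.toSkel ⟨a, u⟩) (Vtx.toSkel ⟨b, u.traverse p hp⟩) ℓ := by
  induction p generalizing a with
  | nil =>
    have hab : a = b := hp
    subst hab
    rw [Fiber.traverse_nil]
    exact ⟨0, .refl _ trivial⟩
  | cons d p ih =>
    obtain ⟨h1, h2⟩ := hp
    have h3 : φ.torusGraph.IsWalk a [d] (φ.torusGraph.terminus d) := ⟨h1, rfl⟩
    obtain ⟨ℓ, hℓ⟩ := ih (u.traverse [d] h3) h2
    rw [Fiber.traverse_traverse] at hℓ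
    have step : ∃ ℓ, φ.PathIn univ (Vtx.toSkel ⟨a, u⟩)
        (Vtx.toSkel ⟨_, u.traverse [d] h3⟩) ℓ := by
      obtain ⟨c, s⟩ := d
      cases s with
      | true =>
        obtain rfl := h1
        rcases c with e | w
        · exact ⟨_, PathIn.fullEdge (.inl ⟨e, u⟩) fun _ _ => trivial⟩
        · exact ⟨_, PathIn.fullEdge (.inr ⟨w, u⟩) fun _ _ => trivial⟩
      | false =>
        obtain rfl := h1
        rcases c with e | w
        · exact exists_pathIn_back_inl e u
        · exact exists_pathIn_back_inr w u
    obtain ⟨k, hk⟩ := step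
    exact ⟨_, hk.trans hℓ⟩

theorem exists_pathIn_base (u : φ.Vtx) :
    ∃ ℓ, φ.PathIn univ (Vtx.toSkel ⟨φ.base, Quot.mk _ ⟨[], rfl⟩⟩) u.toSkel ℓ := by
  obtain ⟨w, u⟩ := u
  induction u using Quot.ind with
  | mk r => exact exists_pathIn_traverse _ r.1 r.2

theorem exists_pathIn (x y : φ.Skel) : ∃ ℓ, φ.PathIn univ x y ℓ := by
  have key : ∀ x : φ.Skel, ∃ ℓ,
      φ.PathIn univ (Vtx.toSkel ⟨φ.base, Quot.mk _ ⟨[], rfl⟩⟩) x ℓ := by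
    intro x
    obtain ⟨c, s, hs, rfl⟩ := exists_edgePt x
    obtain ⟨ℓ, hℓ⟩ := exists_pathIn_base (edgeStart c)
    rw [← edgePt_zero] at hℓ
    exact ⟨_, hℓ.trans (PathIn.edge c ⟨le_rfl, zero_le_one⟩ hs fun _ _ => trivial)⟩
  obtain ⟨k, hk⟩ := key x
  obtain ⟨l, hl⟩ := key y
  exact ⟨_, hk.symm.trans hl⟩

noncomputable instance : PseudoMetricSpace φ.Skel :=
  PseudoEMetricSpace.toPseudoMetricSpace fun x y => by
    obtain ⟨ℓ, hℓ⟩ := exists_pathIn x y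
    exact ne_top_of_le_ne_top hℓ.ne_top (iInf₂_le ℓ hℓ)

theorem dist_edgePt_le (c : φ.CoverEdge) {s t : ℝ} (hs : s ∈ Icc (0 : ℝ) 1)
    (ht : t ∈ Icc (0 : ℝ) 1) : dist (φ.edgePt c s) (φ.edgePt c t) ≤ |s - t| * φ.edgeLen c := by
  have h : edist (φ.edgePt c s) (φ.edgePt c t) ≤ ENNReal.ofReal (|s - t| * φ.edgeLen c) :=
    iInf₂_le _ (PathIn.edge c hs ht fun _ _ => mem_univ _)
  rw [edist_dist] at h
  exact (ENNReal.ofReal_le_ofReal_iff (mul_nonneg (abs_nonneg _) (edgeLen_pos c).le)).1 h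

/-- Paths have arc length parametrizations. -/
theorem PathIn.lipJoined {Y : Set φ.Skel} {x y : φ.Skel} {ℓ : ℝ≥0∞} (h : φ.PathIn Y x y ℓ) :
    LipJoined Y ℓ.toReal x y := by
  induction h with
  | refl x hx => exact ⟨fun _ => x, rfl, rfl, fun _ _ => hx, fun s _ t _ => by simp⟩
  | cons c s t hs ht hY y ℓ h ih =>
    have hl := edgeLen_pos c
    have hk0 : 0 ≤ |s - t| * φ.edgeLen c := mul_nonneg (abs_nonneg _) hl.le
    have hr0 : 0 ≤ ℓ.toReal := ENNReal.toReal_nonneg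
    rw [ENNReal.toReal_add ENNReal.ofReal_ne_top h.ne_top, ENNReal.toReal_ofReal hk0]
    set k := |s - t| * φ.edgeLen c with hk
    set r := ℓ.toReal
    have hst : k = 0 → s = t := by
      intro h0
      rcases mul_eq_zero.1 h0 with h0 | h0
      · exact sub_eq_zero.1 (abs_eq_zero.1 h0)
      · exact absurd h0 hl.ne'
    let f : ℝ → φ.Skel := fun u => φ.edgePt c (s + (u / k) * (t - s))
    have hu : ∀ u ∈ Icc 0 k, s + (u / k) * (t - s) ∈ uIcc s t := by
      intro u hu
      have h1 : u / k ∈ Icc (0 : ℝ) 1 := ⟨div_nonneg hu.1 hk0, div_le_one_of_le₀ hu.2 hk0⟩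
      rw [← segment_eq_uIcc, segment_eq_image']
      exact ⟨_, h1, by simp⟩
    have hI : ∀ u ∈ Icc 0 k, s + (u / k) * (t - s) ∈ Icc (0 : ℝ) 1 := fun u h' =>
      (uIcc_subset_Icc hs ht) (hu u h')
    have hf : ∀ u ∈ Icc 0 k, ∀ v ∈ Icc 0 k, dist (f u) (f v) ≤ |u - v| := by
      intro u h1 v h2
      refine (dist_edgePt_le c (hI u h1) (hI v h2)).trans ?_
      rcases hk0.eq_or_lt with h0 | h0
      · rw [← hst h0.symm]; simp
      · have e : s + u / k * (t - s) - (s + v / k * (t - s)) = (u - v) / k * (t - s) := by ring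
        rw [e, abs_mul, abs_div, abs_of_pos h0, abs_sub_comm t s, mul_assoc, ← hk]
        exact (div_mul_cancel₀ _ h0.ne').le
    have hfk : f k = φ.edgePt c t := by
      simp only [f]
      rcases hk0.eq_or_lt with h0 | h0
      · rw [← hst h0.symm]; simp
      · rw [div_self h0.ne']; ring_nf
    have h1 : LipJoined Y k (φ.edgePt c s) (φ.edgePt c t) :=
      ⟨f, by simp [f], hfk, fun u h' => hY _ (hu u h'), hf⟩
    obtain ⟨g, hg0, -, hg1, hgY, hg⟩ := h1.concat hk0 hr0 ih
    exact ⟨g, hg0, hg1, hgY, hg⟩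

/-! ### Geodesics -/

theorem exists_finite_params (y : φ.Skel) : ∃ P : Set ℝ, P.Finite ∧ 0 ∈ P ∧ 1 ∈ P ∧
    P ⊆ Icc 0 1 ∧ ∀ c, ∀ s ∈ Icc (0 : ℝ) 1, φ.edgePt c s = y → s ∈ P := by
  obtain ⟨c, s, hs, rfl⟩ := exists_edgePt y
  refine ⟨{0, 1, s}, by simp, by simp, by simp, ?_, fun c' s' hs' h => ?_⟩
  · rintro r (rfl | rfl | rfl)
    · exact ⟨le_rfl, zero_le_one⟩
    · exact ⟨zero_le_one, le_rfl⟩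
    · exact hs
  · rcases hs'.1.eq_or_lt with rfl | h0
    · simp
    rcases hs'.2.eq_or_lt with rfl | h1
    · simp
    simp [(edgePt_interior ⟨h0, h1⟩ hs h).2]

theorem PathIn.exists_params {x y : φ.Skel} {ℓ : ℝ≥0∞} {P : Set ℝ} (h0 : 0 ∈ P) (h1 : 1 ∈ P)
    (hP : P ⊆ Icc 0 1) (hy : ∀ c, ∀ s ∈ Icc (0 : ℝ) 1, φ.edgePt c s = y → s ∈ P)
    (h : φ.PathIn univ x y ℓ) :
    ∃ c, ∃ s ∈ Icc (0 : ℝ) 1, ∃ t ∈ P, ∃ r ∈ AddSubmonoid.closure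
        {a | ∃ s ∈ P, ∃ t ∈ P, ∃ c : φ.CoverEdge, a = |s - t| * φ.edgeLen c},
      x = φ.edgePt c s ∧ φ.PathIn univ (φ.edgePt c t) y (ENNReal.ofReal r) ∧
        ENNReal.ofReal (|s - t| * φ.edgeLen c) + ENNReal.ofReal r ≤ ℓ := by
  induction h with
  | refl x hx =>
    obtain ⟨c, s, hs, rfl⟩ := exists_edgePt x
    refine ⟨c, s, hs, s, hy c s hs rfl, 0, zero_mem _, rfl, ?_, by simp⟩
    simpa using PathIn.refl _ (mem_univ _)
  | cons c s t hs ht hY y ℓ h ih =>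
    obtain ⟨c', s', hs', t', ht', r, hr, he, hp, hle⟩ := ih hy
    by_cases hti : t ∈ Ioo (0 : ℝ) 1
    · obtain ⟨rfl, rfl⟩ := edgePt_interior hti hs' he
      refine ⟨c, s, hs, t', ht', r, hr, rfl, hp, ?_⟩
      refine le_trans ?_ (add_le_add_right hle _)
      rw [← add_assoc]
      gcongr
      rw [← ENNReal.ofReal_add (mul_nonneg (abs_nonneg _) (edgeLen_pos c).le)
        (mul_nonneg (abs_nonneg _) (edgeLen_pos c).le), ← add_mul]
      exact ENNReal.ofReal_le_ofReal (mul_le_mul_of_nonneg_right (abs_sub_le _ _ _)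
        (edgeLen_pos c).le)
    · have htP : t ∈ P := by
        rcases ht.1.eq_or_lt with rfl | h0'
        · exact h0
        rcases ht.2.eq_or_lt with rfl | h1'
        · exact h1
        exact absurd ⟨h0', h1'⟩ hti
      have hsP : s' ∈ P := by
        by_contra hc
        have hsi : s' ∈ Ioo (0 : ℝ) 1 := by
          refine ⟨hs'.1.lt_of_ne ?_, hs'.2.lt_of_ne ?_⟩
          · rintro rfl; exact hc h0
          · rintro rfl; exact hc h1
        obtain ⟨rfl, rfl⟩ := edgePt_interior hsi ht he.symm
        exact hti hsi
      have hn : 0 ≤ |s' - t'| * φ.edgeLen c' := mul_nonneg (abs_nonneg _) (edgeLen_pos c').le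
      have hr0 : 0 ≤ r := by
        refine AddSubmonoid.closure_induction (motive := fun a _ => 0 ≤ a) ?_ le_rfl
          (fun _ _ _ _ => add_nonneg) hr
        rintro _ ⟨s, -, t, -, c, rfl⟩
        exact mul_nonneg (abs_nonneg _) (edgeLen_pos c).le
      refine ⟨c, s, hs, t, htP, |s' - t'| * φ.edgeLen c' + r,
        add_mem (AddSubmonoid.subset_closure ⟨s', hsP, t', ht', c', rfl⟩) hr, rfl, ?_, ?_⟩
      · rw [he, ENNReal.ofReal_add hn hr0]
        exact .cons c' s' t' hs' (hP ht') (fun _ _ => mem_univ _) _ _ hp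
      · rw [ENNReal.ofReal_add hn hr0]
        gcongr

/-- Distances in the 1-skeleton are attained. -/
theorem exists_pathIn_edist [Finite E] (x y : φ.Skel) : φ.PathIn univ x y (edist x y) := by
  obtain ⟨P, hPf, h0, h1, hPI, hPy⟩ := exists_finite_params y
  obtain ⟨Q, hQf, -, -, hQI, hQx⟩ := exists_finite_params x
  set A : Set ℝ := {a | ∃ s ∈ P ∪ Q, ∃ t ∈ P ∪ Q, ∃ c : φ.CoverEdge, a = |s - t| * φ.edgeLen c}
    with hA
  have hAf : A.Finite := by
    have hlen : (range φ.edgeLen).Finite := by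
      refine ((finite_range φ.len).insert 1).subset ?_
      rintro _ ⟨e | u, rfl⟩
      · exact Or.inr ⟨_, rfl⟩
      · exact Or.inl rfl
    refine ((((hPf.union hQf).prod (hPf.union hQf)).prod hlen).image
      fun z => |z.1.1 - z.1.2| * z.2).subset ?_
    rintro _ ⟨s, hs, t, ht, c, rfl⟩
    exact ⟨((s, t), φ.edgeLen c), ⟨⟨hs, ht⟩, mem_range_self c⟩, rfl⟩
  have hA0 : ∀ a ∈ A, 0 ≤ a := by
    rintro _ ⟨s, -, t, -, c, rfl⟩
    exact mul_nonneg (abs_nonneg _) (edgeLen_pos c).le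
  have hpwo := Set.IsPWO.addSubmonoid_closure hA0 hAf.isPWO
  have hc0 : ∀ r ∈ AddSubmonoid.closure A, 0 ≤ r := fun r hr =>
    AddSubmonoid.closure_induction (motive := fun a _ => 0 ≤ a) hA0 le_rfl
      (fun _ _ _ _ => add_nonneg) hr
  have key : ∀ ℓ, φ.PathIn univ x y ℓ → ∃ v ∈ AddSubmonoid.closure A,
      φ.PathIn univ x y (ENNReal.ofReal v) ∧ ENNReal.ofReal v ≤ ℓ := by
    intro ℓ h
    obtain ⟨c, s, hs, t, ht, r, hr, rfl, hp, hle⟩ := h.exists_params h0 h1 hPI hPy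
    have hr' : r ∈ AddSubmonoid.closure A := by
      refine AddSubmonoid.closure_mono ?_ hr
      rintro _ ⟨s, hs, t, ht, c, rfl⟩
      exact ⟨s, .inl hs, t, .inl ht, c, rfl⟩
    have hv : |s - t| * φ.edgeLen c ∈ A := ⟨s, .inr (hQx c s hs rfl), t, .inl ht, c, rfl⟩
    rw [← ENNReal.ofReal_add (hA0 _ hv) (hc0 _ hr')] at hle
    refine ⟨_, add_mem (AddSubmonoid.subset_closure hv) hr', ?_, hle⟩
    rw [ENNReal.ofReal_add (hA0 _ hv) (hc0 _ hr')]
    exact .cons c s t hs (hPI ht) (fun _ _ => mem_univ _) _ _ hp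
  set S : Set ℝ := {v | v ∈ AddSubmonoid.closure A ∧ φ.PathIn univ x y (ENNReal.ofReal v)}
  have hS : S.IsWF := (hpwo.mono fun v hv => hv.1).isWF
  obtain ⟨ℓ, hℓ⟩ := exists_pathIn x y
  obtain ⟨v, hv, hvp, -⟩ := key ℓ hℓ
  have hne : S.Nonempty := ⟨v, hv, hvp⟩
  have hmin := hS.min_mem hne
  have : edist x y = ENNReal.ofReal (hS.min hne) := by
    refine le_antisymm (iInf₂_le _ hmin.2) (le_iInf₂ fun ℓ hℓ => ?_)
    obtain ⟨w, hw, hwp, hle⟩ := key ℓ hℓ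
    exact (ENNReal.ofReal_le_ofReal (hS.min_le hne ⟨hw, hwp⟩)).trans hle
  rw [this]
  exact hmin.2

theorem lipJoined_dist [Finite E] (x y : φ.Skel) : LipJoined univ (dist x y) x y := by
  have := (exists_pathIn_edist x y).lipJoined
  rwa [edist_dist, ENNReal.toReal_ofReal dist_nonneg] at this

theorem isGeodesic_of_lipschitz {g : ℝ → φ.Skel} {D : ℝ} (hD : 0 ≤ D)
    (hg : ∀ s ∈ Icc 0 D, ∀ t ∈ Icc 0 D, dist (g s) (g t) ≤ |s - t|)
    (h : D ≤ dist (g 0) (g D)) : φ.IsGeodesic g D := by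
  have main : ∀ s ∈ Icc 0 D, ∀ t ∈ Icc 0 D, s ≤ t → dist (g s) (g t) = |s - t| := by
    intro s hs t ht hst
    refine le_antisymm (hg s hs t ht) ?_
    have h1 := hg 0 ⟨le_rfl, hD⟩ s hs
    have h2 := hg t ht D ⟨hD, le_rfl⟩
    have h3 := dist_triangle4 (g 0) (g s) (g t) (g D)
    rw [abs_of_nonpos (by linarith [hs.1])] at h1
    rw [abs_of_nonpos (by linarith [ht.2])] at h2
    rw [abs_of_nonpos (by linarith)]
    linarith
  refine ⟨hD, fun s hs t ht => ?_⟩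
  rw [edist_dist]
  rcases le_total s t with hst | hst
  · rw [main s hs t ht hst]
  · rw [dist_comm, abs_sub_comm, main t ht s hs hst]

theorem IsGeodesic.dist_eq {g : ℝ → φ.Skel} {D : ℝ} (h : φ.IsGeodesic g D) {s t : ℝ}
    (hs : s ∈ Icc 0 D) (ht : t ∈ Icc 0 D) : dist (g s) (g t) = |s - t| := by
  have := h.2 s hs t ht
  rw [edist_dist] at this
  exact (ENNReal.ofReal_eq_ofReal_iff dist_nonneg (abs_nonneg _)).1 this

theorem IsGeodesic.mbtw {g : ℝ → φ.Skel} {D : ℝ} (h : φ.IsGeodesic g D) {s : ℝ}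
    (hs : s ∈ Icc 0 D) : MBtw (g 0) (g s) (g D) := by
  have hD := h.1
  rw [MBtw, h.dist_eq ⟨le_rfl, hD⟩ hs, h.dist_eq hs ⟨hD, le_rfl⟩,
    h.dist_eq ⟨le_rfl, hD⟩ ⟨hD, le_rfl⟩, abs_of_nonpos (by linarith [hs.1]),
    abs_of_nonpos (by linarith [hs.2]), abs_of_nonpos (by linarith)]
  ring

theorem exists_isGeodesic_through [Finite E] {x p y : φ.Skel} (h : MBtw x p y) :
    ∃ (g : ℝ → φ.Skel) (D : ℝ), φ.IsGeodesic g D ∧ g 0 = x ∧ g D = y ∧ p ∈ g '' Icc 0 D := by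
  have h1 : 0 ≤ dist x p := dist_nonneg
  have h2 : 0 ≤ dist p y := dist_nonneg
  obtain ⟨g, rfl, hp, hy, -, hg⟩ := (lipJoined_dist x p).concat dist_nonneg dist_nonneg
    (lipJoined_dist p y)
  rw [h] at hy hg
  refine ⟨g, _, isGeodesic_of_lipschitz dist_nonneg hg (by rw [hy]), rfl, hy, _, ⟨h1, ?_⟩, hp⟩
  rw [← h]
  linarith

theorem exists_isGeodesic [Finite E] (x y : φ.Skel) :
    ∃ (g : ℝ → φ.Skel) (D : ℝ), φ.IsGeodesic g D ∧ g 0 = x ∧ g D = y := by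
  obtain ⟨g, D, h, h0, h1, -⟩ := exists_isGeodesic_through (x := x) (p := x) (y := y)
    (by simp [MBtw])
  exact ⟨g, D, h, h0, h1⟩

theorem IsHyperbolic.isSlim [Finite E] {δ : ℝ} (h : φ.IsHyperbolic δ) : IsSlim φ.Skel δ where
  nonneg := h.1
  exists_btw x y t h0 ht := by
    obtain ⟨g, hg0, hg1, -, hg⟩ := lipJoined_dist x y
    have h1 := hg 0 ⟨le_rfl, dist_nonneg⟩ t ⟨h0, ht⟩
    have h2 := hg t ⟨h0, ht⟩ _ ⟨dist_nonneg, le_rfl⟩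
    rw [hg0, abs_of_nonpos (by linarith)] at h1
    rw [hg1, abs_of_nonpos (by linarith)] at h2
    have h3 := dist_triangle x (g t) y
    refine ⟨g t, ?_, ?_⟩
    · unfold MBtw; linarith
    · linarith
  slim ε hε x y z p hp := by
    obtain ⟨g₁, D₁, h₁, rfl, rfl, hpg⟩ := exists_isGeodesic_through hp
    obtain ⟨g₂, D₂, h₂, e₂, rfl⟩ := exists_isGeodesic (g₁ D₁) z
    obtain ⟨g₃, D₃, h₃, e₃, e₃'⟩ := exists_isGeodesic (g₂ D₂) (g₁ 0)
    have h4 := h.2 g₁ g₂ g₃ D₁ D₂ D₃ h₁ h₂ h₃ e₂.symm e₃.symm e₃' hpg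
    have h5 := Metric.cthickening_subset_thickening' (δ₂ := δ + ε) (by linarith [h.1])
      (by linarith) _ h4
    obtain ⟨p', hp', hd⟩ := Metric.mem_thickening_iff.1 h5
    refine ⟨p', hd.le, ?_⟩
    rcases hp' with ⟨s, hs, rfl⟩ | ⟨s, hs, rfl⟩
    · have := h₂.mbtw hs
      rw [e₂] at this
      exact .inr this.symm
    · have := h₃.mbtw hs
      rw [e₃, e₃'] at this
      exact .inl this.symm

theorem _root_.MQuasiconvex.isQuasiconvex {R : ℝ} {Y : Set φ.Skel} (h : MQuasiconvex R Y) :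
    φ.IsQuasiconvex R Y := by
  rintro γ D hγ h0 hD _ ⟨s, hs, rfl⟩
  obtain ⟨z, hz, hd⟩ := h _ h0 _ hD _ (hγ.mbtw hs)
  exact Metric.mem_cthickening_of_dist_le _ _ _ _ hz hd

theorem IsQuasiconvex.mquasiconvex [Finite E] {R R' : ℝ} {Y : Set φ.Skel}
    (h : φ.IsQuasiconvex R Y) (hR : R < R') (h0 : 0 < R') : MQuasiconvex R' Y := by
  intro x hx y hy p hp
  obtain ⟨g, D, hg, rfl, rfl, hpg⟩ := exists_isGeodesic_through hp
  obtain ⟨z, hz, hd⟩ := Metric.mem_thickening_iff.1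
    (Metric.cthickening_subset_thickening' h0 hR _ (h g D hg hx hy hpg))
  exact ⟨z, hz, hd.le⟩

/-! ### Heights -/

/-- The total exponent of the horizontal edges in an edge path of the mapping torus. -/
def wordHeight (p : List ((E ⊕ V) × Bool)) : ℤ :=
  (p.map fun d => Sum.elim (fun _ => 0) (fun _ => cond d.2 1 (-1)) d.1).sum

theorem wordHeight_append (p q : List ((E ⊕ V) × Bool)) :
    wordHeight (p ++ q) = wordHeight p + wordHeight q := by
  simp [wordHeight]

theorem wordHeight_vert (p : List (E × Bool)) : wordHeight (vert (V := V) p) = 0 := by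
  simp [wordHeight, vert, Function.comp_def]

/-- The height of a vertex of the universal cover. -/
def Fiber.height {w : V} : φ.Fiber w → ℤ :=
  Quot.lift (fun p => wordHeight p.1) (by
    rintro ⟨p, hp⟩ ⟨q, hq⟩ (h : φ.ElemHomotopy p q)
    change wordHeight p = wordHeight q
    cases h with
    | backtrack x y c b =>
      cases c <;> cases b <;> simp [wordHeight]
    | cell x y e =>
      have := wordHeight_vert (V := V) (φ.mapE e)
      have h1 := wordHeight_append (vert (V := V) (φ.mapE e)) y
      simp only [wordHeight_append] at *
      simp [wordHeight] at *
      omega)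

theorem Fiber.height_traverse {a b : V} (u : φ.Fiber a) (p : List ((E ⊕ V) × Bool))
    (hp : φ.torusGraph.IsWalk a p b) : (u.traverse p hp).height = u.height + wordHeight p := by
  induction u using Quot.ind with
  | mk r => exact wordHeight_append _ _

theorem Fiber.height_shift {w : V} (u : φ.Fiber w) : u.shift.height = u.height + 1 :=
  u.height_traverse _ _

/-- The height of a point over `V`. -/
def VPoint.height : φ.VPoint → ℤ
  | .vertex u => u.height
  | .inner e _ => e.start.height

theorem LiftEdge.height_finish (e : φ.LiftEdge) : e.finish.height = e.start.height :=
  (e.start.height_traverse _ _).trans (add_zero _)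

@[simp] theorem LiftEdge.height_pt (e : φ.LiftEdge) (s : ℝ) : (e.pt s).height = e.start.height := by
  unfold LiftEdge.pt
  split_ifs
  · rfl
  · rfl
  · exact e.height_finish

/-- The lifted edge traversed by the lift of the oriented edge `d` that starts at `u`. -/
def alongEdge : (d : E × Bool) → φ.Fiber (φ.toOGraph.origin d) → φ.LiftEdge
  | (e, true), u => ⟨e, u⟩
  | (e, false), u => ⟨e, u.traverse [(Sum.inl e, false)] ⟨rfl, rfl⟩⟩

theorem along_eq (d : E × Bool) (u : φ.Fiber (φ.toOGraph.origin d)) (s : ℝ) :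
    Fiber.along d u s = (alongEdge d u).pt (cond d.2 s (1 - s)) := by
  obtain ⟨e, _ | _⟩ := d <;> rfl

theorem height_alongEdge (d : E × Bool) (u : φ.Fiber (φ.toOGraph.origin d)) :
    (alongEdge d u).start.height = u.height := by
  obtain ⟨e, _ | _⟩ := d
  · exact (Fiber.height_traverse u [(Sum.inl e, false)] ⟨rfl, rfl⟩).trans (add_zero _)
  · rfl

/-- The `i`-th vertex of the image of a lifted edge under the forward flow. -/
def LiftEdge.imageVertex (e : φ.LiftEdge) (i : ℕ) (hi : i < (φ.mapE e.edge).length) :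
    φ.Fiber (φ.toOGraph.origin (φ.mapE e.edge)[i]) :=
  e.start.shift.traverse (vert ((φ.mapE e.edge).take i))
    (φ.vert_isWalk ((φ.mapE_isWalk e.edge).take _ i hi))

/-- The `i`-th edge of the image of a lifted edge under the forward flow. -/
def LiftEdge.imageEdge (e : φ.LiftEdge) (i : ℕ) (hi : i < (φ.mapE e.edge).length) : φ.LiftEdge :=
  alongEdge (φ.mapE e.edge)[i] (e.imageVertex i hi)

theorem LiftEdge.height_imageVertex (e : φ.LiftEdge) (i : ℕ) (hi : i < (φ.mapE e.edge).length) :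
    (e.imageVertex i hi).height = e.start.height + 1 := by
  rw [imageVertex, Fiber.height_traverse, wordHeight_vert, add_zero, Fiber.height_shift]

/-- The parameter of the image of the point of a lifted edge `e` with parameter `s`. -/
noncomputable def imageParam (φ : GraphMap V E) (e : E) (s : ℝ) : ℝ :=
  let i := φ.piece e s
  let t := (s - φ.brk e i) / (φ.brk e (i + 1) - φ.brk e i)
  cond ((φ.mapE e)[i]'(φ.piece_lt e s)).2 t (1 - t)

theorem flow_inner (e : φ.LiftEdge) (s : Ioo (0 : ℝ) 1) : φ.flow (.inner e s) =
    (e.imageEdge (φ.piece e.edge s) (φ.piece_lt e.edge s)).pt (imageParam φ e.edge s) :=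
  along_eq _ _ _

theorem height_flow (x : φ.VPoint) : (φ.flow x).height = x.height + 1 := by
  cases x with
  | vertex u => exact u.height_shift
  | inner e s =>
    rw [flow_inner, LiftEdge.height_pt, LiftEdge.imageEdge, height_alongEdge,
      LiftEdge.height_imageVertex]
    rfl

theorem height_flow_iterate (n : ℕ) (x : φ.VPoint) :
    (φ.flow^[n] x).height = x.height + n := by
  induction n with
  | zero => simp
  | succ n ih => rw [Function.iterate_succ_apply', height_flow, ih]; push_cast; ring

/-- The height of a point of the 1-skeleton. -/
noncomputable def skelHeight (x : φ.Skel) : ℝ := x.1.1.height + x.1.2.1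

theorem skelHeight_toSkel (x : φ.VPoint) : skelHeight x.toSkel = x.height := by
  simp [skelHeight, VPoint.toSkel, VPoint.toPt]

theorem skelHeight_edgePt_inl (e : φ.LiftEdge) (s : ℝ) :
    skelHeight (φ.edgePt (.inl e) s) = e.start.height := by
  rw [edgePt, skelHeight_toSkel, LiftEdge.height_pt]

theorem skelHeight_edgePt_inr (u : φ.Vtx) {s : ℝ} (hs : s ∈ Icc (0 : ℝ) 1) :
    skelHeight (φ.edgePt (.inr u) s) = u.2.height + s := by
  rcases hs.2.eq_or_lt with rfl | h
  · rw [edgePt_one, Vtx.toSkel, skelHeight_toSkel]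
    simp [VPoint.height, edgeFinish, Fiber.height_shift]
  · rw [skelHeight, edgePt_inr_val u ⟨hs.1, h⟩]
    rfl

theorem PathIn.abs_skelHeight_sub_le {Y : Set φ.Skel} {x y : φ.Skel} {ℓ : ℝ≥0∞}
    (h : φ.PathIn Y x y ℓ) : |skelHeight x - skelHeight y| ≤ ℓ.toReal := by
  induction h with
  | refl x hx => simp
  | cons c s t hs ht hY y ℓ h ih =>
    have h0 : 0 ≤ |s - t| * φ.edgeLen c := mul_nonneg (abs_nonneg _) (edgeLen_pos c).le
    rw [ENNReal.toReal_add ENNReal.ofReal_ne_top h.ne_top, ENNReal.toReal_ofReal h0]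
    refine (abs_sub_le _ (skelHeight (φ.edgePt c t)) _).trans (add_le_add ?_ ih)
    rcases c with e | u
    · rw [skelHeight_edgePt_inl, skelHeight_edgePt_inl, sub_self, abs_zero]
      exact h0
    · rw [skelHeight_edgePt_inr u hs, skelHeight_edgePt_inr u ht, add_sub_add_left_eq_sub]
      simp [edgeLen]

theorem abs_skelHeight_sub_le_dist [Finite E] (x y : φ.Skel) :
    |skelHeight x - skelHeight y| ≤ dist x y := by
  have := (exists_pathIn_edist x y).abs_skelHeight_sub_le
  rwa [edist_dist, ENNReal.toReal_ofReal dist_nonneg] at this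

/-! ### Carriers -/

theorem carrier_isSubcomplex (S : Set φ.Pt) : φ.IsSubcomplex (φ.carrier S) where
  vertical e s h r hr := by
    rintro Z ⟨hZ, hS⟩
    exact hZ.vertical e s (h Z ⟨hZ, hS⟩) r hr
  horizontal u h h0 hm := by
    refine ⟨fun h' => ?_, ?_⟩
    · rintro Z ⟨hZ, hS⟩
      exact (hZ.horizontal u h h0 (hm Z ⟨hZ, hS⟩)).1 h'
    · rintro Z ⟨hZ, hS⟩
      exact (hZ.horizontal u h h0 (hm Z ⟨hZ, hS⟩)).2
  cell e s h h0 hm r hr := by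
    refine ⟨fun h' => ?_, ?_⟩
    · rintro Z ⟨hZ, hS⟩
      exact (hZ.cell e s h h0 (hm Z ⟨hZ, hS⟩) r hr).1 h'
    · rintro Z ⟨hZ, hS⟩
      exact (hZ.cell e s h h0 (hm Z ⟨hZ, hS⟩) r hr).2

theorem subset_carrier (S : Set φ.Pt) : S ⊆ φ.carrier S := fun _ hx _ hZ => hZ.2 hx

theorem carrier_subset {S Z : Set φ.Pt} (hZ : φ.IsSubcomplex Z) (h : S ⊆ Z) : φ.carrier S ⊆ Z :=
  fun _ hx => hx Z ⟨hZ, h⟩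

theorem carrier_mono {S T : Set φ.Pt} (h : S ⊆ T) : φ.carrier S ⊆ φ.carrier T :=
  carrier_subset (carrier_isSubcomplex T) (h.trans (subset_carrier T))

theorem IsSubcomplex.iUnion {ι : Sort*} {Z : ι → Set φ.Pt} (h : ∀ i, φ.IsSubcomplex (Z i)) :
    φ.IsSubcomplex (⋃ i, Z i) where
  vertical e s hm r hr := by
    obtain ⟨i, hi⟩ := mem_iUnion.1 hm
    exact mem_iUnion.2 ⟨i, (h i).vertical e s hi r hr⟩
  horizontal u k h0 hm := by
    obtain ⟨i, hi⟩ := mem_iUnion.1 hm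
    exact ⟨fun h' => mem_iUnion.2 ⟨i, ((h i).horizontal u k h0 hi).1 h'⟩,
      mem_iUnion.2 ⟨i, ((h i).horizontal u k h0 hi).2⟩⟩
  cell e s k h0 hm r hr := by
    obtain ⟨i, hi⟩ := mem_iUnion.1 hm
    exact ⟨fun h' => mem_iUnion.2 ⟨i, ((h i).cell e s k h0 hi r hr).1 h'⟩,
      mem_iUnion.2 ⟨i, ((h i).cell e s k h0 hi r hr).2⟩⟩

theorem carrier_biUnion_subset {ι : Type*} (I : Set ι) (S : ι → Set φ.Pt) :
    φ.carrier (⋃ i ∈ I, S i) ⊆ ⋃ i ∈ I, φ.carrier (S i) :=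
  carrier_subset (.iUnion fun _ => .iUnion fun _ => carrier_isSubcomplex _)
    (biUnion_mono subset_rfl fun i _ => subset_carrier (S i))

theorem exists_mem_carrier_singleton {S : Set φ.Pt} {p : φ.Pt} (h : p ∈ φ.carrier S) :
    ∃ s ∈ S, p ∈ φ.carrier {s} := by
  rw [← biUnion_of_singleton S] at h
  simpa using carrier_biUnion_subset S (fun s => {s}) h

/-- The closed cell of the preimage of `V` that contains `x` in its interior. -/
def VPoint.cell : φ.VPoint → Set φ.VPoint
  | .vertex u => {.vertex u}
  | .inner e _ => e.pt '' Icc 0 1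

theorem LiftEdge.cell_pt_subset (e : φ.LiftEdge) (r : ℝ) : (e.pt r).cell ⊆ e.pt '' Icc 0 1 := by
  unfold LiftEdge.pt
  split_ifs with h h'
  · exact subset_rfl
  · rintro _ rfl
    exact ⟨0, by simp, e.pt_zero⟩
  · rintro _ rfl
    exact ⟨1, by simp, e.pt_one⟩

theorem VPoint.self_mem_cell (x : φ.VPoint) : x ∈ x.cell := by
  cases x with
  | vertex u => rfl
  | inner e s => exact ⟨s, ⟨s.2.1.le, s.2.2.le⟩, e.pt_inner s⟩

theorem VPoint.cell_subset {x y : φ.VPoint} (h : y ∈ x.cell) : y.cell ⊆ x.cell := by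
  cases x with
  | vertex u => obtain rfl := h; rfl
  | inner e s => obtain ⟨r, hr, rfl⟩ := h; exact e.cell_pt_subset r

theorem VPoint.height_of_mem_cell {x y : φ.VPoint} (h : y ∈ x.cell) : y.height = x.height := by
  cases x with
  | vertex u => obtain rfl := h; rfl
  | inner e s => obtain ⟨r, hr, rfl⟩ := h; exact e.height_pt r

/-- The smallest subcomplex that contains the midsegment of `x`. -/
def VPoint.prism (x : φ.VPoint) : Set φ.Pt :=
  {p | p.1 ∈ x.cell} ∪ VPoint.toPt '' {z | ∃ y ∈ x.cell, z ∈ (φ.flow y).cell}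

theorem isSubcomplex_cell (x : φ.VPoint) : φ.IsSubcomplex (VPoint.toPt '' x.cell) where
  vertical e s := by
    rintro ⟨y, hy, he⟩ r hr
    obtain rfl : y = .inner e s := congrArg Prod.fst he
    exact ⟨_, VPoint.cell_subset hy ⟨r, hr, rfl⟩, rfl⟩
  horizontal u h h0 := by
    rintro ⟨y, hy, he⟩
    exact absurd (congrArg (fun z => z.2.1) he) h0.ne
  cell e s h h0 := by
    rintro ⟨y, hy, he⟩
    exact absurd (congrArg (fun z => z.2.1) he) h0.ne

theorem isSubcomplex_prism (x : φ.VPoint) : φ.IsSubcomplex x.prism where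
  vertical e s := by
    rintro (h | ⟨z, ⟨y, hy, hz⟩, he⟩) r hr
    · exact .inl (VPoint.cell_subset (y := .inner e s) h ⟨r, hr, rfl⟩)
    · obtain rfl : z = .inner e s := congrArg Prod.fst he
      exact .inr ⟨_, ⟨y, hy, VPoint.cell_subset hz ⟨r, hr, rfl⟩⟩, rfl⟩
  horizontal u h h0 := by
    rintro (hm | ⟨y, hy, he⟩)
    · exact ⟨fun h' => .inl hm, .inr ⟨_, ⟨_, hm, VPoint.self_mem_cell _⟩, rfl⟩⟩
    · exact absurd (congrArg (fun z => z.2.1) he) h0.ne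
  cell e s h h0 := by
    rintro (hm | ⟨y, hy, he⟩) r hr
    · have : e.pt r ∈ x.cell := VPoint.cell_subset (y := .inner e s) hm ⟨r, hr, rfl⟩
      exact ⟨fun h' => .inl this, .inr ⟨_, ⟨_, this, VPoint.self_mem_cell _⟩, rfl⟩⟩
    · exact absurd (congrArg (fun z => z.2.1) he) h0.ne

theorem IsSubcomplex.cell_subset {Z : Set φ.Pt} (hZ : φ.IsSubcomplex Z) {x : φ.VPoint}
    (h : x.toPt ∈ Z) : VPoint.toPt '' x.cell ⊆ Z := by
  rintro _ ⟨y, hy, rfl⟩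
  cases x with
  | vertex u => obtain rfl := hy; exact h
  | inner e s => obtain ⟨r, hr, rfl⟩ := hy; exact hZ.vertical e s h r hr

theorem IsSubcomplex.prism_subset {Z : Set φ.Pt} (hZ : φ.IsSubcomplex Z) {x : φ.VPoint}
    {h : Ico (0 : ℝ) 1} (h0 : 0 < h.1) (hx : (x, h) ∈ Z) : x.prism ⊆ Z := by
  have key : ∀ y ∈ x.cell, (∀ h', (y, h') ∈ Z) ∧ (φ.flow y).toPt ∈ Z := by
    intro y hy
    cases x with
    | vertex u => obtain rfl := hy; exact hZ.horizontal u h h0 hx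
    | inner e s => obtain ⟨r, hr, rfl⟩ := hy; exact hZ.cell e s h h0 hx r hr
  rintro p (hp | ⟨z, ⟨y, hy, hz⟩, rfl⟩)
  · exact (key _ hp).1 _
  · exact hZ.cell_subset (key y hy).2 ⟨z, hz, rfl⟩

theorem carrier_singleton_subset_prism (x : φ.VPoint) (h : Ico (0 : ℝ) 1) :
    φ.carrier {(x, h)} ⊆ x.prism :=
  carrier_subset (isSubcomplex_prism x) (singleton_subset_iff.2 (.inl x.self_mem_cell))

theorem carrier_singleton_subset_cell (x : φ.VPoint) :
    φ.carrier {x.toPt} ⊆ VPoint.toPt '' x.cell :=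
  carrier_subset (isSubcomplex_cell x) (singleton_subset_iff.2 ⟨x, x.self_mem_cell, rfl⟩)

end GraphMap

theorem OGraph.IsWalk.terminus_unique {V E : Type*} {G : OGraph V E} {a b c : V}
    {p : List (E × Bool)} (hb : G.IsWalk a p b) (hc : G.IsWalk a p c) : b = c := by
  induction p generalizing a with
  | nil => exact Eq.trans (Eq.symm hb) hc
  | cons d p ih => exact ih hb.2 hc.2

namespace GraphMap

variable {V E : Type*} {φ : GraphMap V E}

/-- There is a path of length at most `r` from `x` to `y` in `Y`. -/
def WithinDist (Y : Set φ.Skel) (r : ℝ) (x y : φ.Skel) : Prop :=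
  0 ≤ r ∧ ∃ ℓ, φ.PathIn Y x y ℓ ∧ ℓ ≤ ENNReal.ofReal r

namespace WithinDist

variable {Y : Set φ.Skel} {r s : ℝ} {x y z : φ.Skel}

theorem refl (h : x ∈ Y) : WithinDist Y 0 x x := ⟨le_rfl, 0, .refl x h, by simp⟩

theorem symm (h : WithinDist Y r x y) : WithinDist Y r y x := by
  obtain ⟨h0, ℓ, h, hl⟩ := h
  exact ⟨h0, ℓ, h.symm, hl⟩

theorem trans (h : WithinDist Y r x y) (h' : WithinDist Y s y z) : WithinDist Y (r + s) x z := by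
  obtain ⟨h0, ℓ, h, hl⟩ := h
  obtain ⟨h0', ℓ', h', hl'⟩ := h'
  refine ⟨add_nonneg h0 h0', _, h.trans h', ?_⟩
  rw [ENNReal.ofReal_add h0 h0']
  gcongr

theorem mono (h : WithinDist Y r x y) (hrs : r ≤ s) : WithinDist Y s x y := by
  obtain ⟨h0, ℓ, h, hl⟩ := h
  exact ⟨h0.trans hrs, ℓ, h, hl.trans (ENNReal.ofReal_le_ofReal hrs)⟩

theorem mono_set {Z : Set φ.Skel} (h : WithinDist Y r x y) (hYZ : Y ⊆ Z) : WithinDist Z r x y := by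
  obtain ⟨h0, ℓ, h, hl⟩ := h
  exact ⟨h0, ℓ, h.mono hYZ, hl⟩

theorem pathDist_le (h : WithinDist Y r x y) : φ.pathDist Y x y ≤ ENNReal.ofReal r := by
  obtain ⟨h0, ℓ, h, hl⟩ := h
  exact (iInf₂_le ℓ h).trans hl

theorem dist_le (h : WithinDist Y r x y) : dist x y ≤ r := by
  have h1 := (edist_le_pathDist Y x y).trans h.pathDist_le
  rw [edist_dist] at h1
  exact (ENNReal.ofReal_le_ofReal_iff h.1).1 h1

theorem lipJoined (h : WithinDist Y r x y) : ∃ ℓ, 0 ≤ ℓ ∧ ℓ ≤ r ∧ LipJoined Y ℓ x y := by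
  obtain ⟨h0, ℓ, h, hl⟩ := h
  exact ⟨ℓ.toReal, ENNReal.toReal_nonneg, ENNReal.toReal_le_of_le_ofReal h0 hl, h.lipJoined⟩

theorem of_pathDist_lt (h0 : 0 ≤ r) (h : φ.pathDist Y x y < ENNReal.ofReal r) :
    WithinDist Y r x y := by
  unfold pathDist at h
  simp only [iInf_lt_iff] at h
  obtain ⟨ℓ, hp, hl⟩ := h
  exact ⟨h0, ℓ, hp, hl.le⟩

theorem edge (c : φ.CoverEdge) (hY : ∀ q ∈ Icc (0 : ℝ) 1, φ.edgePt c q ∈ Y)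
    (hs : s ∈ Icc (0 : ℝ) 1) (hr : r ∈ Icc (0 : ℝ) 1) :
    WithinDist Y (φ.edgeLen c) (φ.edgePt c s) (φ.edgePt c r) := by
  refine ⟨(edgeLen_pos c).le, _,
    PathIn.edge c hs hr fun q hq => hY q (uIcc_subset_Icc hs hr hq), ?_⟩
  apply ENNReal.ofReal_le_ofReal
  have : |s - r| ≤ 1 := abs_le.2 ⟨by linarith [hs.1, hr.2], by linarith [hs.2, hr.1]⟩
  exact mul_le_of_le_one_left (edgeLen_pos c).le this

end WithinDist

theorem Fiber.traverse_congr {a b b' : V} (u : φ.Fiber a) {p q : List ((E ⊕ V) × Bool)}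
    (h : p = q) (hp : φ.torusGraph.IsWalk a p b) (hq : φ.torusGraph.IsWalk a q b') :
    (⟨b, u.traverse p hp⟩ : φ.Vtx) = ⟨b', u.traverse q hq⟩ := by
  subst h
  obtain rfl := hp.terminus_unique hq
  rfl

theorem edgePt_alongEdge_origin (d : E × Bool) (u : φ.Fiber (φ.toOGraph.origin d)) :
    φ.edgePt (.inl (alongEdge d u)) (cond d.2 0 1) = Vtx.toSkel ⟨_, u⟩ := by
  obtain ⟨e, _ | _⟩ := d
  · exact (edgePt_one _).trans (congrArg Vtx.toSkel (edgeFinish_back_inl e u))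
  · exact edgePt_zero _

theorem edgePt_alongEdge_terminus (d : E × Bool) (u : φ.Fiber (φ.toOGraph.origin d))
    (h : φ.torusGraph.IsWalk (φ.toOGraph.origin d) [(Sum.inl d.1, d.2)] (φ.toOGraph.terminus d)) :
    φ.edgePt (.inl (alongEdge d u)) (cond d.2 1 0) = Vtx.toSkel ⟨_, u.traverse _ h⟩ := by
  obtain ⟨e, _ | _⟩ := d
  · exact edgePt_zero _
  · exact edgePt_one _

theorem LiftEdge.imageVertex_succ (e : φ.LiftEdge) (i : ℕ)
    (hi : i + 1 < (φ.mapE e.edge).length) :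
    φ.edgePt (.inl (e.imageEdge i (Nat.lt_of_succ_lt hi)))
        (cond ((φ.mapE e.edge)[i]).2 1 0) = Vtx.toSkel ⟨_, e.imageVertex (i + 1) hi⟩ := by
  set d := (φ.mapE e.edge)[i] with hd
  have hw : φ.torusGraph.IsWalk (φ.toOGraph.origin d) [(Sum.inl d.1, d.2)]
      (φ.toOGraph.terminus d) := φ.vert_isWalk (p := [d]) ⟨rfl, rfl⟩
  refine (edgePt_alongEdge_terminus d _ hw).trans (congrArg _ ?_)
  rw [imageVertex, Fiber.traverse_traverse]
  apply Fiber.traverse_congr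
  rw [List.take_succ_eq_append_getElem (Nat.lt_of_succ_lt hi)]
  simp only [vert, List.map_append, List.map_cons, List.map_nil, hd]

theorem piece_eq (e : E) {i : ℕ} (hi : i < (φ.mapE e).length) {s : ℝ} (h1 : φ.brk e i ≤ s)
    (h2 : s < φ.brk e (i + 1)) : φ.piece e s = i := by
  classical
  unfold piece
  rw [Nat.findGreatest_eq_iff]
  refine ⟨by omega, fun _ => h1, fun n hn hn' hs => ?_⟩
  have := (φ.brk_strictMono e).monotoneOn (a := i + 1) (b := n) (by simp; omega) (by simp; omega) hn
  linarith

theorem exists_flow_eq_imageEdge (e : φ.LiftEdge) (i : ℕ) (hi : i < (φ.mapE e.edge).length) :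
    ∃ r ∈ Icc (0 : ℝ) 1, ∃ t ∈ Ioo (0 : ℝ) 1, φ.flow (e.pt r) = (e.imageEdge i hi).pt t := by
  have hm := φ.brk_strictMono e.edge
  have hlt : φ.brk e.edge i < φ.brk e.edge (i + 1) := hm (by simp; omega) (by simp; omega) (by omega)
  have h0 : 0 ≤ φ.brk e.edge i := by
    rw [← φ.brk_zero e.edge]
    exact hm.monotoneOn (by simp) (by simp; omega) (Nat.zero_le _)
  have h1 : φ.brk e.edge (i + 1) ≤ 1 := by
    rw [← φ.brk_length e.edge]
    exact hm.monotoneOn (by simp; omega) (by simp) hi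
  set a := φ.brk e.edge i with ha
  set b := φ.brk e.edge (i + 1) with hb
  have hr : (a + b) / 2 ∈ Ioo (0 : ℝ) 1 := ⟨by linarith, by linarith⟩
  have hp : φ.piece e.edge ((a + b) / 2) = i := piece_eq e.edge hi (by linarith) (by linarith)
  have hpar : imageParam φ e.edge ((a + b) / 2) = 1 / 2 := by
    have : ((a + b) / 2 - a) / (b - a) = 1 / 2 := by
      have : b - a ≠ 0 := by linarith
      field_simp; ring
    unfold imageParam
    simp only [hp, ← ha, ← hb, this]
    cases ((φ.mapE e.edge)[i]).2 <;> norm_num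
  refine ⟨(a + b) / 2, ⟨hr.1.le, hr.2.le⟩, 1 / 2, by constructor <;> norm_num, ?_⟩
  have h3 := e.pt_inner ⟨_, hr⟩
  simp only at h3
  rw [h3, flow_inner, hpar]
  simp only [hp]

/-- A vertex of the closed cell of `x`. -/
def VPoint.refVertex : φ.VPoint → φ.Vtx
  | .vertex u => ⟨_, u⟩
  | .inner e _ => ⟨_, e.start⟩

theorem VPoint.refVertex_mem (x : φ.VPoint) : .vertex x.refVertex.2 ∈ x.cell := by
  cases x with
  | vertex u => rfl
  | inner e s => exact ⟨0, by simp, e.pt_zero⟩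

variable (φ) in
/-- `Λ` bounds the weights of the edges, `N` the lengths of their images. -/
structure EdgeBound (Λ : ℝ) (N : ℕ) : Prop where
  one_le : 1 ≤ Λ
  len_le : ∀ e, φ.len e ≤ Λ
  length_le : ∀ e, (φ.mapE e).length ≤ N

theorem exists_edgeBound [Finite E] (φ : GraphMap V E) : ∃ Λ N, φ.EdgeBound Λ N := by
  obtain ⟨Λ, hΛ⟩ := (finite_range φ.len).bddAbove
  obtain ⟨N, hN⟩ := (finite_range fun e => (φ.mapE e).length).bddAbove
  exact ⟨max 1 Λ, N, le_max_left _ _, fun e => (hΛ ⟨e, rfl⟩).trans (le_max_right _ _),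
    fun e => hN ⟨e, rfl⟩⟩

namespace EdgeBound

variable {Λ : ℝ} {N : ℕ} {Y : Set φ.Skel}

theorem edgeLen_le (hb : φ.EdgeBound Λ N) (c : φ.CoverEdge) : φ.edgeLen c ≤ Λ := by
  rcases c with e | u
  · exact hb.len_le _
  · exact hb.one_le

theorem withinDist_edge (hb : φ.EdgeBound Λ N)
    (c : φ.CoverEdge) (hY : ∀ q ∈ Icc (0 : ℝ) 1, φ.edgePt c q ∈ Y)
    {s r : ℝ} (hs : s ∈ Icc (0 : ℝ) 1) (hr : r ∈ Icc (0 : ℝ) 1) :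
    WithinDist Y Λ (φ.edgePt c s) (φ.edgePt c r) :=
  (WithinDist.edge c hY hs hr).mono (hb.edgeLen_le c)

theorem withinDist_cell (hb : φ.EdgeBound Λ N)
    {x y z : φ.VPoint} (hY : VPoint.toSkel '' x.cell ⊆ Y) (hy : y ∈ x.cell)
    (hz : z ∈ x.cell) : WithinDist Y Λ y.toSkel z.toSkel := by
  cases x with
  | vertex u =>
    obtain rfl := hy
    obtain rfl := hz
    exact (WithinDist.refl (hY ⟨_, rfl, rfl⟩)).mono (zero_le_one.trans hb.one_le)
  | inner e s =>
    obtain ⟨r, hr, rfl⟩ := hy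
    obtain ⟨t, ht, rfl⟩ := hz
    exact hb.withinDist_edge (.inl e) (fun q hq => hY ⟨_, ⟨q, hq, rfl⟩, rfl⟩) hr ht

theorem _root_.GraphMap.prism_horizontal {x : φ.VPoint} (hY : φ.inSkel x.prism ⊆ Y) {u : φ.Vtx}
    (hu : .vertex u.2 ∈ x.cell) (q : ℝ) (hq : q ∈ Icc (0 : ℝ) 1) :
    φ.edgePt (.inr u) q ∈ Y := by
  apply hY
  rcases hq.2.eq_or_lt with rfl | h
  · rw [edgePt_one]
    exact .inr ⟨_, ⟨_, hu, VPoint.self_mem_cell _⟩, rfl⟩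
  · refine Or.inl ?_
    rw [mem_ofPred_eq, edgePt_inr_val u ⟨hq.1, h⟩]
    exact hu

theorem withinDist_imageVertex (hb : φ.EdgeBound Λ N) {e : φ.LiftEdge} {s : Ioo (0 : ℝ) 1}
    (hY : φ.inSkel (VPoint.inner e s).prism ⊆ Y) (i : ℕ) (hi : i < (φ.mapE e.edge).length) :
    (∀ q ∈ Icc (0 : ℝ) 1, φ.edgePt (.inl (e.imageEdge i hi)) q ∈ Y) ∧
    WithinDist Y (i * Λ) (Vtx.toSkel ⟨_, e.start.shift⟩)
      (Vtx.toSkel ⟨_, e.imageVertex i hi⟩) := by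
  have hmem : ∀ i (hi : i < (φ.mapE e.edge).length), ∀ q ∈ Icc (0 : ℝ) 1,
      φ.edgePt (.inl (e.imageEdge i hi)) q ∈ Y := by
    intro i hi q hq
    obtain ⟨r, hr, t, ht, he⟩ := exists_flow_eq_imageEdge e i hi
    refine hY (.inr ⟨_, ⟨e.pt r, ⟨r, hr, rfl⟩, ?_⟩, rfl⟩)
    rw [he]
    have := LiftEdge.pt_inner (e.imageEdge i hi) ⟨t, ht⟩
    simp only at this
    rw [this]
    exact ⟨q, hq, rfl⟩
  refine ⟨hmem i hi, ?_⟩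
  induction i with
  | zero =>
    have : (⟨_, e.imageVertex 0 hi⟩ : φ.Vtx) = ⟨_, e.start.shift⟩ := by
      refine (e.start.shift.traverse_congr (by simp [vert]) _ ?_).trans
        (congrArg (Sigma.mk _) (e.start.shift.traverse_nil ?_)) <;> rfl
    rw [this]
    refine (WithinDist.refl (hY ?_)).mono (by simp)
    exact .inr ⟨_, ⟨e.pt 0, ⟨0, by simp, rfl⟩, by rw [e.pt_zero]; rfl⟩, rfl⟩
  | succ i ih =>
    have hi' := Nat.lt_of_succ_lt hi
    have h1 := ih hi'
    rw [← e.imageVertex_succ i hi]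
    have h2 := edgePt_alongEdge_origin (φ.mapE e.edge)[i] (e.imageVertex i hi')
    rw [← h2] at h1
    refine (h1.trans (hb.withinDist_edge _ (hmem i hi') ?_ ?_)).mono (by push_cast; linarith)
    · cases ((φ.mapE e.edge)[i]).2 <;> simp
    · cases ((φ.mapE e.edge)[i]).2 <;> simp

theorem withinDist_flow_cell (hb : φ.EdgeBound Λ N)
    {x y z : φ.VPoint} (hY : φ.inSkel x.prism ⊆ Y) (hy : y ∈ x.cell)
    (hz : z ∈ (φ.flow y).cell) :
    WithinDist Y (2 * Λ + N * Λ) x.refVertex.toSkel z.toSkel := by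
  have hΛ : 0 ≤ Λ := zero_le_one.trans hb.one_le
  have hNΛ : 0 ≤ N * Λ := by positivity
  have hcell : VPoint.toSkel '' x.cell ⊆ Y := by
    rintro _ ⟨y, hy, rfl⟩
    exact hY (.inl hy)
  have hor : ∀ u : φ.Vtx, .vertex u.2 ∈ x.cell →
      WithinDist Y Λ u.toSkel (VPoint.vertex u.2.shift).toSkel := by
    intro u hu
    have := hb.withinDist_edge (.inr u) (prism_horizontal hY hu) (s := 0) (r := 1) (by simp)
      (by simp)
    rwa [edgePt_zero, edgePt_one] at this
  have vert : ∀ u : φ.Vtx, .vertex u.2 ∈ x.cell →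
      WithinDist Y (2 * Λ + N * Λ) x.refVertex.toSkel (VPoint.vertex u.2.shift).toSkel := by
    intro u hu
    refine ((hb.withinDist_cell hcell x.refVertex_mem hu).trans (hor u hu)).mono (by linarith)
  by_cases hyv : ∃ u : φ.Vtx, y = .vertex u.2
  · obtain ⟨u, rfl⟩ := hyv
    obtain rfl := hz
    exact vert u hy
  cases x with
  | vertex u => exact absurd ⟨⟨_, u⟩, hy⟩ hyv
  | inner e s =>
    obtain ⟨r, hr, rfl⟩ := hy
    have hr' : r ∈ Ioo (0 : ℝ) 1 := by
      refine ⟨hr.1.lt_of_ne ?_, hr.2.lt_of_ne ?_⟩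
      · rintro rfl; exact hyv ⟨⟨_, e.start⟩, e.pt_zero⟩
      · rintro rfl; exact hyv ⟨⟨_, e.finish⟩, e.pt_one⟩
    have h3 := e.pt_inner ⟨r, hr'⟩
    simp only at h3
    rw [h3, flow_inner] at hz
    obtain ⟨q, hq, rfl⟩ := LiftEdge.cell_pt_subset _ _ hz
    simp only at *
    have hi := φ.piece_lt e.edge r
    obtain ⟨hm, hw⟩ := hb.withinDist_imageVertex hY _ hi
    have h2 := edgePt_alongEdge_origin (φ.mapE e.edge)[φ.piece e.edge r] (e.imageVertex _ hi)
    rw [← h2] at hw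
    have h4 := hw.trans (hb.withinDist_edge _ hm (r := q) ?_ hq)
    · refine ((hor ⟨_, e.start⟩ (VPoint.inner e s).refVertex_mem).trans h4).mono ?_
      have : (φ.piece e.edge r : ℝ) ≤ N := by exact_mod_cast hi.le.trans (hb.length_le _)
      have := mul_le_mul_of_nonneg_right this hΛ
      linarith
    · cases ((φ.mapE e.edge)[φ.piece e.edge r]).2 <;> simp

theorem withinDist_prism (hb : φ.EdgeBound Λ N)
    {x : φ.VPoint} (hY : φ.inSkel x.prism ⊆ Y) {a : φ.Skel}
    (ha : a ∈ φ.inSkel x.prism) :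
    WithinDist Y (2 * Λ + N * Λ) x.refVertex.toSkel a ∧ |skelHeight a - x.height| ≤ 1 := by
  have hΛ : 0 ≤ Λ := zero_le_one.trans hb.one_le
  have hNΛ : 0 ≤ N * Λ := by positivity
  have hcell : VPoint.toSkel '' x.cell ⊆ Y := by
    rintro _ ⟨y, hy, rfl⟩
    exact hY (.inl hy)
  rcases ha with ha | ⟨z, ⟨y, hy, hz⟩, he⟩
  · constructor
    · rcases a.2 with h0 | ⟨w, u, hu⟩
      · have : a = a.1.1.toSkel := Skel.ext (Prod.ext rfl (Subtype.ext h0))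
        rw [this]
        exact (hb.withinDist_cell hcell x.refVertex_mem ha).mono (by linarith)
      · rw [mem_ofPred_eq, hu] at ha
        have h1 := hb.withinDist_cell hcell x.refVertex_mem ha
        have h2 := hb.withinDist_edge (.inr ⟨w, u⟩) (prism_horizontal hY (u := ⟨w, u⟩) ha)
          (s := 0) (r := a.1.2) (by simp) ⟨a.1.2.2.1, a.1.2.2.2.le⟩
        have h3 : φ.edgePt (.inr ⟨w, u⟩) a.1.2 = a :=
          Skel.ext ((edgePt_inr_val ⟨w, u⟩ a.1.2.2).trans (Prod.ext hu.symm rfl))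
        rw [h3, edgePt_zero] at h2
        exact (h1.trans h2).mono (by linarith)
    · rw [skelHeight, VPoint.height_of_mem_cell ha, add_sub_cancel_left,
        abs_of_nonneg a.1.2.2.1]
      exact a.1.2.2.2.le
  · have : a = z.toSkel := Skel.ext he.symm
    rw [this]
    refine ⟨hb.withinDist_flow_cell hY hy hz, ?_⟩
    rw [skelHeight_toSkel, VPoint.height_of_mem_cell hz, height_flow, VPoint.height_of_mem_cell hy]
    simp

end EdgeBound

/-! ### Forward ladders -/

variable (φ) in
/-- The 1-skeleton of the carrier of the forward path `σ_M(x)`. -/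
def ladder (M : ℕ) (x : φ.VPoint) : Set φ.Skel := φ.inSkel (φ.carrier (φ.forwardPath M x))

theorem prism_subset_ladder {M i : ℕ} (x : φ.VPoint) (hi : i < M) :
    φ.inSkel (φ.flow^[i] x).prism ⊆ φ.ladder M x := by
  intro a ha
  refine (carrier_isSubcomplex _).prism_subset (x := φ.flow^[i] x) (h := ⟨1 / 2, by norm_num⟩)
    (by norm_num) (subset_carrier _ ?_) ha
  exact .inl ⟨i, hi, rfl⟩

theorem cell_subset_ladder (M : ℕ) (x : φ.VPoint) :
    VPoint.toSkel '' (φ.flow^[M] x).cell ⊆ φ.ladder M x := by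
  rintro _ ⟨y, hy, rfl⟩
  exact (carrier_isSubcomplex _).cell_subset (x := φ.flow^[M] x)
    (subset_carrier _ (.inr rfl)) ⟨y, hy, rfl⟩

namespace EdgeBound

variable {Λ : ℝ} {N : ℕ}

theorem exists_withinDist_refVertex (hb : φ.EdgeBound Λ N) {M : ℕ} {x : φ.VPoint} {a : φ.Skel}
    (ha : a ∈ φ.ladder M x) : ∃ i ≤ M,
      WithinDist (φ.ladder M x) (2 * Λ + N * Λ) (φ.flow^[i] x).refVertex.toSkel a ∧
        |skelHeight a - (x.height + i)| ≤ 1 := by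
  have hΛ : 0 ≤ Λ := zero_le_one.trans hb.one_le
  have hNΛ : 0 ≤ N * Λ := by positivity
  obtain ⟨⟨s, h⟩, hs, hp⟩ := exists_mem_carrier_singleton ha
  rcases hs with ⟨i, hi, rfl⟩ | hs
  · refine ⟨i, hi.le, ?_⟩
    have := hb.withinDist_prism (prism_subset_ladder x hi) (carrier_singleton_subset_prism _ _ hp)
    rw [height_flow_iterate] at this
    exact_mod_cast this
  · refine ⟨M, le_rfl, ?_⟩
    obtain ⟨rfl, rfl⟩ := Prod.mk.inj hs
    obtain ⟨z, hz, he⟩ := carrier_singleton_subset_cell _ hp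
    have : a = z.toSkel := Skel.ext he.symm
    rw [this]
    refine ⟨(hb.withinDist_cell (cell_subset_ladder M x) (VPoint.refVertex_mem _) hz).mono
      (by linarith), ?_⟩
    rw [skelHeight_toSkel, VPoint.height_of_mem_cell hz, height_flow_iterate]
    simp

theorem withinDist_refVertex (hb : φ.EdgeBound Λ N) {M : ℕ} (x : φ.VPoint) {i j : ℕ} (hij : i ≤ j)
    (hj : j ≤ M) : WithinDist (φ.ladder M x) ((j - i) * (2 * Λ + N * Λ))
      (φ.flow^[i] x).refVertex.toSkel (φ.flow^[j] x).refVertex.toSkel := by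
  induction j, hij using Nat.le_induction with
  | base =>
    refine (WithinDist.refl ?_).mono (by simp)
    rcases hj.eq_or_lt with rfl | hj
    · exact cell_subset_ladder _ _ ⟨_, VPoint.refVertex_mem _, rfl⟩
    · exact prism_subset_ladder x hj (.inl (VPoint.refVertex_mem _))
  | succ j hij ih =>
    refine ((ih (by omega)).trans (hb.withinDist_flow_cell (prism_subset_ladder x hj)
      (VPoint.self_mem_cell _) (z := .vertex (φ.flow^[j + 1] x).refVertex.2) ?_)).mono ?_
    · rw [Function.iterate_succ_apply']
      exact VPoint.refVertex_mem _
    · push_cast; linarith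

/-- Forward ladders are quasi-isometrically embedded: path distances are controlled by heights. -/
theorem ladder_withinDist (hb : φ.EdgeBound Λ N) {M : ℕ} {x : φ.VPoint} {a b : φ.Skel}
    (ha : a ∈ φ.ladder M x) (hbm : b ∈ φ.ladder M x) :
    WithinDist (φ.ladder M x) (4 * (2 * Λ + N * Λ) * (|skelHeight a - skelHeight b| + 1)) a b := by
  have hΛ : 0 ≤ Λ := zero_le_one.trans hb.one_le
  have hC : 0 ≤ 2 * Λ + N * Λ := by positivity
  obtain ⟨i, hi, hia, hi'⟩ := hb.exists_withinDist_refVertex ha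
  obtain ⟨j, hj, hjb, hj'⟩ := hb.exists_withinDist_refVertex hbm
  set C := 2 * Λ + N * Λ
  set d := |skelHeight a - skelHeight b| with hd
  have hd0 : 0 ≤ d := abs_nonneg _
  have hij : WithinDist (φ.ladder M x) ((d + 2) * C) (φ.flow^[i] x).refVertex.toSkel
      (φ.flow^[j] x).refVertex.toSkel := by
    have h1 := le_abs_self (skelHeight a - skelHeight b)
    have h2 := neg_le_abs (skelHeight a - skelHeight b)
    rw [abs_le] at hi' hj'
    rcases le_total i j with h | h
    · refine (hb.withinDist_refVertex x h hj).mono (mul_le_mul_of_nonneg_right ?_ hC)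
      linarith
    · refine (hb.withinDist_refVertex x h hi).symm.mono (mul_le_mul_of_nonneg_right ?_ hC)
      linarith
  refine ((hia.symm.trans hij).trans hjb).mono ?_
  nlinarith

theorem ladder_withinDist_dist [Finite E] (hb : φ.EdgeBound Λ N) {M : ℕ} {x : φ.VPoint}
    {a b : φ.Skel} (ha : a ∈ φ.ladder M x) (hbm : b ∈ φ.ladder M x) :
    WithinDist (φ.ladder M x) (4 * (2 * Λ + N * Λ) * (dist a b + 1)) a b := by
  have hΛ : 0 ≤ Λ := zero_le_one.trans hb.one_le
  refine (hb.ladder_withinDist ha hbm).mono ?_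
  have := abs_skelHeight_sub_le_dist a b
  gcongr

end EdgeBound

theorem exists_ladder_mquasiconvex [Finite E] {δ : ℝ} (h : IsSlim φ.Skel δ) :
    ∃ R, 0 ≤ R ∧ ∀ (M : ℕ) (x : φ.VPoint), MQuasiconvex R (φ.ladder M x) := by
  obtain ⟨Λ, N, hb⟩ := exists_edgeBound φ
  obtain ⟨R, hR, hq⟩ := h.exists_quasiconvex (4 * (2 * Λ + N * Λ))
  exact ⟨R, hR, fun M x => hq _ fun a ha b hbm => (hb.ladder_withinDist_dist ha hbm).lipJoined⟩

theorem ladderConst_nonneg : 0 ≤ φ.ladderConst := Real.sInf_nonneg fun _ h => h.1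

theorem ladder_mquasiconvex [Finite E] {δ : ℝ} (h : IsSlim φ.Skel δ) {r : ℝ}
    (hr : φ.ladderConst < r) (M : ℕ) (x : φ.VPoint) : MQuasiconvex r (φ.ladder M x) := by
  obtain ⟨R, hR0, hR⟩ := exists_ladder_mquasiconvex h
  have hne : {r | 0 ≤ r ∧ ∀ (M : ℕ) (x : φ.VPoint),
      φ.IsQuasiconvex r (φ.inSkel (φ.carrier (φ.forwardPath M x)))}.Nonempty :=
    ⟨R, hR0, fun M x => (hR M x).isQuasiconvex⟩
  obtain ⟨s, hs, hsr⟩ := exists_lt_of_csInf_lt hne hr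
  exact (hs.2 M x).mquasiconvex hsr (ladderConst_nonneg.trans_lt hr)

/-- Paths inside the preimage of `V` have constant height. -/
theorem PathIn.skelHeight_eq {Y : Set φ.Skel} (hY : Y ⊆ range VPoint.toSkel) {x y : φ.Skel}
    {ℓ : ℝ≥0∞} (h : φ.PathIn Y x y ℓ) : skelHeight x = skelHeight y := by
  induction h with
  | refl x hx => rfl
  | cons c s t hs ht hc y ℓ h ih =>
    rw [← ih]
    rcases c with e | u
    · rw [skelHeight_edgePt_inl, skelHeight_edgePt_inl]
    · by_cases hst : s = t
      · rw [hst]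
      exfalso
      have hr : (s + t) / 2 ∈ Ioo (0 : ℝ) 1 := by
        rcases lt_or_gt_of_ne hst with h | h
        · constructor <;> linarith [hs.1, hs.2, ht.1, ht.2]
        · constructor <;> linarith [hs.1, hs.2, ht.1, ht.2]
      have hm : (s + t) / 2 ∈ uIcc s t := by
        rcases le_total s t with h | h
        · rw [uIcc_of_le h]; constructor <;> linarith
        · rw [uIcc_of_ge h]; constructor <;> linarith
      obtain ⟨z, hz⟩ := hY (hc _ hm)
      have h1 := congrArg Subtype.val hz
      rw [edgePt_inr_val u ⟨hr.1.le, hr.2⟩] at h1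
      exact hr.1.ne (congrArg (fun z => z.2.1) h1)

namespace Busts

variable {D : φ.Busts}

/-- The point to which the approximation map sends a point of a nucleus or a level-part. -/
noncomputable def Piece.approxPt : D.Piece → φ.VPoint
  | .nucleusPt x => φ.flow^[D.L] x
  | .level τ => τ.q
  | .slope τ => τ.q

/-- Pieces other than slopes. -/
def Piece.IsLevel (a : D.Piece) : Prop := ∀ τ, a ≠ .slope τ

theorem Piece.isLevel_level (τ : D.Root) : (Piece.level τ : D.Piece).IsLevel := nofun

theorem Piece.IsLevel.approx_eq {a : D.Piece} (h : a.IsLevel) :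
    D.approx a = {a.approxPt.toPt} := by
  cases a with
  | nucleusPt x => rfl
  | level τ => rfl
  | slope τ => exact absurd rfl (h τ)

theorem Root.height_q (τ : D.Root) : τ.q.height = τ.edge.start.height := LiftEdge.height_pt _ _

theorem Root.height_p (τ : D.Root) : τ.p.height = τ.edge.start.height := LiftEdge.height_pt _ _

theorem LevelJoin.height_eq {a b : D.Piece} (h : D.LevelJoin a b) :
    a.approxPt.height = b.approxPt.height := by
  cases h with
  | nucleus x y ℓ h =>
    have := h.skelHeight_eq (image_subset_range _ _)
    rw [skelHeight_toSkel, skelHeight_toSkel] at this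
    have h' : x.height = y.height := by exact_mod_cast this
    simp only [Piece.approxPt, height_flow_iterate, h']
  | leaf x τ h => simp only [Piece.approxPt, h]

theorem LevelJoin.isLevel {a b : D.Piece} (h : D.LevelJoin a b) : a.IsLevel ∧ b.IsLevel := by
  cases h with
  | nucleus x y ℓ h => exact ⟨nofun, nofun⟩
  | leaf x τ h => exact ⟨nofun, nofun⟩

theorem knockoutOf_eq {a b : D.Piece} (h : b ∈ D.knockoutOf a) :
    D.knockoutOf a = D.knockoutOf b :=
  Set.ext fun _ => ⟨fun hc => (Relation.EqvGen.symm _ _ h).trans _ _ _ hc, fun hc => h.trans _ _ _ hc⟩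

theorem self_mem_knockoutOf (a : D.Piece) : a ∈ D.knockoutOf a := .refl a

theorem height_eq_of_mem_knockoutOf {a b : D.Piece} (h : b ∈ D.knockoutOf a) :
    a.approxPt.height = b.approxPt.height := by
  induction h with
  | rel a b h => exact h.height_eq
  | refl => rfl
  | symm a b _ ih => exact ih.symm
  | trans a b c _ _ h1 h2 => exact h1.trans h2

theorem isLevel_iff_of_mem_knockoutOf {a b : D.Piece} (h : b ∈ D.knockoutOf a) :
    a.IsLevel ↔ b.IsLevel := by
  induction h with
  | rel a b h => exact iff_of_true h.isLevel.1 h.isLevel.2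
  | refl => rfl
  | symm a b _ ih => exact ih.symm
  | trans a b c _ _ h1 h2 => exact h1.trans h2

theorem knockoutOf_subset_wallPieces {c : φ.VPoint} {a : D.Piece} (h : a ∈ D.wallPieces c) :
    D.knockoutOf a ⊆ D.wallPieces c := fun _ hb =>
  h.trans _ _ _ (hb.mono fun _ _ h => .ofLevel _ _ h)

variable (D) in
/-- The image under the approximation map of the knockout of `a`, in the 1-skeleton. -/
def knockoutImage (a : D.Piece) : Set φ.Skel := φ.inSkel (D.approxSet (D.knockoutOf a))

theorem mem_knockoutImage {a : D.Piece} (ha : a.IsLevel) {x : φ.Skel} :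
    x ∈ D.knockoutImage a ↔ ∃ b ∈ D.knockoutOf a, x = b.approxPt.toSkel := by
  constructor
  · intro h
    obtain ⟨b, hb, hx⟩ := mem_iUnion₂.1 h
    rw [((isLevel_iff_of_mem_knockoutOf hb).1 ha).approx_eq] at hx
    exact ⟨b, hb, Skel.ext hx⟩
  · rintro ⟨b, hb, rfl⟩
    refine mem_iUnion₂.2 ⟨b, hb, ?_⟩
    rw [((isLevel_iff_of_mem_knockoutOf hb).1 ha).approx_eq]
    rfl

theorem skelHeight_of_mem_knockoutImage {a : D.Piece} (ha : a.IsLevel) {x : φ.Skel}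
    (hx : x ∈ D.knockoutImage a) : skelHeight x = a.approxPt.height := by
  obtain ⟨b, hb, rfl⟩ := (mem_knockoutImage ha).1 hx
  rw [skelHeight_toSkel, height_eq_of_mem_knockoutOf hb]

/-! ### Tunnels -/

/-- The two ends of a tunnel: its level-part, and the tip of its slope. -/
noncomputable def Root.endPiece (τ : D.Root) : Bool → D.Piece
  | false => .level τ
  | true => .nucleusPt τ.p

theorem Root.isLevel_endPiece (τ : D.Root) (s : Bool) : (τ.endPiece s).IsLevel := by
  cases s <;> exact nofun

theorem Root.height_endPiece (τ : D.Root) (s : Bool) :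
    (τ.endPiece s).approxPt.height = τ.edge.start.height + cond s (D.L : ℤ) 0 := by
  cases s with
  | false => simp [endPiece, Piece.approxPt, height_q]
  | true => simp [endPiece, Piece.approxPt, height_flow_iterate, height_p]

theorem Root.param_p_mem (τ : D.Root) : (cond τ.upper (D.lo τ.edge.edge) (D.hi τ.edge.edge)) ∈
    Ioo (0 : ℝ) 1 := by
  have h0 := D.lo_pos _ τ.mem
  have h1 := D.lo_lt_hi _ τ.mem
  have h2 := D.hi_lt_one _ τ.mem
  cases τ.upper
  · exact ⟨h0.trans h1, h2⟩
  · exact ⟨h0, h1.trans h2⟩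

theorem carrier_tunnel (τ : D.Root) :
    φ.carrier (D.approxSet {.level τ, .slope τ}) = φ.carrier (φ.forwardPath D.L τ.p) := by
  have h0 := D.lo_pos _ τ.mem
  have h1 := D.lo_lt_hi _ τ.mem
  have h2 := D.hi_lt_one _ τ.mem
  apply Subset.antisymm
  · apply carrier_subset (carrier_isSubcomplex _)
    have hp : (VPoint.inner τ.edge ⟨_, τ.param_p_mem⟩).toPt ∈
        φ.carrier (φ.forwardPath D.L τ.p) := by
      apply subset_carrier
      rw [← LiftEdge.pt_inner]
      exact .inl ⟨0, D.one_le_L, rfl⟩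
    have he := (carrier_isSubcomplex _).vertical _ _ hp
    intro x hx
    simp only [approxSet, mem_insert_iff, mem_singleton_iff, iUnion_iUnion_eq_or_left,
      iUnion_iUnion_eq_left] at hx
    rcases hx with rfl | ⟨s, hs, rfl⟩ | hx
    · apply he
      cases τ.upper
      · exact ⟨h0.le, (h1.trans h2).le⟩
      · exact ⟨(h0.trans h1).le, h2.le⟩
    · exact he s ⟨h0.le.trans hs.1, hs.2.trans h2.le⟩
    · exact subset_carrier _ hx
  · apply carrier_mono
    intro x hx
    exact mem_iUnion₂.2 ⟨.slope τ, by simp, .inr hx⟩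

theorem tunnelCarrier_eq (τ : D.Root) : D.tunnelCarrier τ = φ.ladder D.L τ.p :=
  congrArg φ.inSkel (carrier_tunnel τ)

theorem endPiece_mem_tunnelCarrier (τ : D.Root) (s : Bool) :
    (τ.endPiece s).approxPt.toSkel ∈ D.tunnelCarrier τ := by
  cases s with
  | false => exact subset_carrier _ (mem_iUnion₂.2 ⟨.level τ, by simp, rfl⟩)
  | true => exact subset_carrier _ (mem_iUnion₂.2 ⟨.slope τ, by simp, .inr (.inr rfl)⟩)

theorem carrier_slope_subset (τ : D.Root) :
    φ.inSkel (φ.carrier (D.approx (.slope τ))) ⊆ D.tunnelCarrier τ := by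
  intro x hx
  exact carrier_mono (fun y hy => mem_iUnion₂.2 ⟨.slope τ, by simp, hy⟩) hx

theorem endPiece_mem_wallPieces {c : φ.VPoint} {τ : D.Root} {s : Bool}
    (h : τ.endPiece s ∈ D.wallPieces c) :
    Piece.level τ ∈ D.wallPieces c ∧ Piece.slope τ ∈ D.wallPieces c ∧
      ∀ s', τ.endPiece s' ∈ D.wallPieces c := by
  have h1 : Relation.EqvGen D.Join (.level τ) (.slope τ) := .rel _ _ (.root τ)
  have h2 : Relation.EqvGen D.Join (.slope τ) (.nucleusPt τ.p) := .rel _ _ (.tip τ)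
  have h3 : Piece.slope τ ∈ D.wallPieces c := by
    cases s with
    | false => exact h.trans _ _ _ h1
    | true => exact h.trans _ _ _ h2.symm
  have h4 : Piece.level τ ∈ D.wallPieces c := h3.trans _ _ _ h1.symm
  refine ⟨h4, h3, fun s' => ?_⟩
  cases s' with
  | false => exact h4
  | true => exact h3.trans _ _ _ h2

theorem slope_mem_wallPieces {c : φ.VPoint} {τ : D.Root} (h : Piece.slope τ ∈ D.wallPieces c) :
    Piece.level τ ∈ D.wallPieces c :=
  h.trans _ _ _ (Relation.EqvGen.rel _ _ (.root τ)).symm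

variable (D) in
/-- `N(A(W̄))¹`. -/
def wallCarrier (c : φ.VPoint) : Set φ.Skel := φ.inSkel (φ.carrier (D.approxSet (D.wallPieces c)))

theorem knockoutImage_subset {c : φ.VPoint} {a : D.Piece} (h : a ∈ D.wallPieces c) :
    D.knockoutImage a ⊆ D.wallCarrier c := fun _ hx =>
  subset_carrier _ (biUnion_mono (knockoutOf_subset_wallPieces h) (fun _ _ => subset_rfl) hx)

theorem tunnelCarrier_subset {c : φ.VPoint} {τ : D.Root} (h : Piece.level τ ∈ D.wallPieces c) :
    D.tunnelCarrier τ ⊆ D.wallCarrier c := fun _ hx => by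
  refine carrier_mono (biUnion_mono ?_ fun _ _ => subset_rfl) hx
  rintro _ (rfl | rfl)
  · exact h
  · exact (endPiece_mem_wallPieces (s := false) h).2.1

/-! ### Points attached to knockouts -/

/-- `x` belongs to the image of the knockout of `a` (and then `o = x`), or to the carrier of a
tunnel that has an end in that knockout; then `o` is the image of this end. -/
def Hang (a : D.Piece) (o x : φ.Skel) : Option D.Root → Prop
  | none => o = x ∧ x ∈ D.knockoutImage a
  | some τ => x ∈ D.tunnelCarrier τ ∧
      ∃ s, τ.endPiece s ∈ D.knockoutOf a ∧ o = (τ.endPiece s).approxPt.toSkel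

theorem Hang.base_mem {a : D.Piece} (ha : a.IsLevel) {o x : φ.Skel} {t : Option D.Root}
    (h : Hang a o x t) : o ∈ D.knockoutImage a := by
  cases t with
  | none => rw [h.1]; exact h.2
  | some τ =>
    obtain ⟨-, s, hs, rfl⟩ := h
    exact (mem_knockoutImage ha).2 ⟨_, hs, rfl⟩

theorem Hang.congr {a b : D.Piece} (hb : b ∈ D.knockoutOf a) {o x : φ.Skel} {t : Option D.Root}
    (h : Hang a o x t) : Hang b o x t := by
  unfold Hang knockoutImage at *
  rwa [knockoutOf_eq hb] at h

/-- There is a reduced path of knockouts and tunnels from the knockout or tunnel that contains `x` to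
the knockout of the given piece; its last tunnel is recorded. -/
inductive Reach (c : φ.VPoint) (x : φ.Skel) : Option D.Root → D.Piece → Prop
  | hang (a : D.Piece) (t : Option D.Root) (o : φ.Skel) (ha : a.IsLevel) (hw : a ∈ D.wallPieces c) :
      Hang a o x t → Reach c x t a
  | step (t : Option D.Root) (a : D.Piece) (τ : D.Root) (s : Bool) (ha : a.IsLevel)
      (hw : a ∈ D.wallPieces c) (hs : τ.endPiece s ∈ D.knockoutOf a) (ht : t ≠ some τ)
      (b : D.Piece) (hb : b ∈ D.knockoutOf (τ.endPiece !s)) :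
      Reach c x t a → Reach c x (some τ) b

theorem Reach.isLevel {c : φ.VPoint} {x : φ.Skel} {t : Option D.Root} {a : D.Piece}
    (h : Reach c x t a) : a.IsLevel := by
  cases h with
  | hang a t o ha hw h => exact ha
  | step t a τ s ha hw hs ht b hb h =>
    exact (isLevel_iff_of_mem_knockoutOf hb).1 (τ.isLevel_endPiece _)

theorem Reach.mem_wallPieces {c : φ.VPoint} {x : φ.Skel} {t : Option D.Root} {a : D.Piece}
    (h : Reach c x t a) : a ∈ D.wallPieces c := by
  cases h with
  | hang a t o ha hw h => exact hw
  | step t a τ s ha hw hs ht b hb h =>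
    have h1 := knockoutOf_subset_wallPieces hw hs
    exact knockoutOf_subset_wallPieces ((endPiece_mem_wallPieces h1).2.2 _) hb

theorem Reach.congr {c : φ.VPoint} {x : φ.Skel} {t : Option D.Root} {a b : D.Piece}
    (h : Reach c x t a) (hb : b ∈ D.knockoutOf a) : Reach c x t b := by
  cases h with
  | hang a t o ha hw h =>
    exact .hang b t o ((isLevel_iff_of_mem_knockoutOf hb).1 ha)
      (knockoutOf_subset_wallPieces hw hb) (h.congr hb)
  | step t a τ s ha hw hs ht b' hb' h =>
    exact .step t a τ s ha hw hs ht b (hb'.trans _ _ _ hb) h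

theorem endPiece_not_mem_knockoutOf (τ : D.Root) (s : Bool) :
    τ.endPiece (!s) ∉ D.knockoutOf (τ.endPiece s) := by
  intro h
  have h1 := height_eq_of_mem_knockoutOf h
  rw [τ.height_endPiece, τ.height_endPiece] at h1
  have := D.one_le_L
  cases s <;> simp at h1 <;> omega

theorem Reach.tunnel {c : φ.VPoint} {x : φ.Skel} {t : Option D.Root} {τ : D.Root} {s : Bool}
    (h : Reach c x t (τ.endPiece s)) : ∃ t', Reach c x t' (τ.endPiece !s) := by
  by_cases ht : t = some τ
  · subst ht
    have hw := (endPiece_mem_wallPieces h.mem_wallPieces).2.2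
    generalize hE : τ.endPiece s = e at h
    cases h with
    | hang a t o ha hw' h =>
      exact ⟨some τ, .hang _ _ _ (τ.isLevel_endPiece _) (hw _)
        ⟨h.1, !s, self_mem_knockoutOf _, rfl⟩⟩
    | step t a τ' s' ha hw hs ht b hb h =>
      subst hE
      by_cases hss : s = s'
      · subst hss
        exact absurd (hb.symm) (endPiece_not_mem_knockoutOf τ s)
      · obtain rfl : s' = !s := by cases s <;> cases s' <;> simp_all
        exact ⟨t, h.congr hs⟩
  · exact ⟨some τ, .step t _ τ s (τ.isLevel_endPiece s) h.mem_wallPieces (self_mem_knockoutOf _) ht _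
      (self_mem_knockoutOf _) h⟩

/-- The piece itself, or the level-part attached to a slope. -/
def Piece.anchor : D.Piece → D.Piece
  | .slope τ => .level τ
  | a => a

theorem Piece.IsLevel.anchor_eq {a : D.Piece} (h : a.IsLevel) : a.anchor = a := by
  cases a with
  | nucleusPt x => rfl
  | level τ => rfl
  | slope τ => exact absurd rfl (h τ)

theorem exists_reach_iff {c : φ.VPoint} {x : φ.Skel} {a b : D.Piece}
    (h : Relation.EqvGen D.Join a b) :
    (∃ t, Reach c x t a.anchor) ↔ ∃ t, Reach c x t b.anchor := by
  induction h with
  | rel a b h =>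
    cases h with
    | ofLevel a b h =>
      rw [h.isLevel.1.anchor_eq, h.isLevel.2.anchor_eq]
      have hb : b ∈ D.knockoutOf a := .rel _ _ h
      exact ⟨fun ⟨t, ht⟩ => ⟨t, ht.congr hb⟩, fun ⟨t, ht⟩ => ⟨t, ht.congr hb.symm⟩⟩
    | root τ => rfl
    | tip τ =>
      exact ⟨fun ⟨t, ht⟩ => Reach.tunnel (τ := τ) (s := false) ht,
        fun ⟨t, ht⟩ => Reach.tunnel (τ := τ) (s := true) ht⟩
  | refl => rfl
  | symm a b _ ih => exact ih.symm
  | trans a b c _ _ h1 h2 => exact h1.trans h2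

/-- Two points of the approximation of a wall are joined by a reduced path of knockouts and tunnels,
unless they belong to a common tunnel. -/
theorem exists_reach_hang {c : φ.VPoint} {x y o o' : φ.Skel} {a b : D.Piece} {t t' : Option D.Root}
    (ha : a.IsLevel) (hb : b.IsLevel) (haw : a ∈ D.wallPieces c) (hbw : b ∈ D.wallPieces c)
    (hx : Hang a o x t) (hy : Hang b o' y t') :
    (∃ τ, Piece.level τ ∈ D.wallPieces c ∧ x ∈ D.tunnelCarrier τ ∧ y ∈ D.tunnelCarrier τ) ∨
      ∃ s d o₁, Reach c x s d ∧ Hang d o₁ y t' ∧ (s ≠ t' ∨ t' = none) := by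
  have hab : Relation.EqvGen D.Join a b := haw.symm.trans _ _ _ hbw
  obtain ⟨s, hs⟩ := (exists_reach_iff (c := c) (x := x) hab).1
    ⟨t, by rw [ha.anchor_eq]; exact .hang a t o ha haw hx⟩
  rw [hb.anchor_eq] at hs
  by_cases hst : s = t'
  swap
  · exact .inr ⟨s, b, o', hs, hy, .inl hst⟩
  subst hst
  cases s with
  | none => exact .inr ⟨none, b, o', hs, hy, .inr rfl⟩
  | some τ =>
    cases hs with
    | hang _ _ o₂ _ _ h =>
      obtain ⟨hyτ, s, hs, -⟩ := hy
      exact .inl ⟨τ, (endPiece_mem_wallPieces (knockoutOf_subset_wallPieces hbw hs)).1, h.1, hyτ⟩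
    | step t₁ a₁ _ s₁ ha₁ hw₁ hs₁ ht₁ _ hb₁ h =>
      exact .inr ⟨t₁, a₁, _, h, ⟨hy.1, s₁, hs₁, rfl⟩, .inl ht₁⟩

variable (D) in
/-- Local control on the approximation of a wall: tunnels and knockouts are quasi-isometrically
embedded, and a path through a tunnel, a knockout and another tunnel is nearly aligned. -/
structure WallBounds (v : φ.VPoint) (c C : ℝ) : Prop where
  one_le : 1 ≤ c
  nonneg : 0 ≤ C
  tunnel : ∀ τ : D.Root, Piece.level τ ∈ D.wallPieces v → ∀ x ∈ D.tunnelCarrier τ,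
    ∀ y ∈ D.tunnelCarrier τ, WithinDist (D.wallCarrier v) (c * (dist x y + 1)) x y
  knockout : ∀ a : D.Piece, a.IsLevel → a ∈ D.wallPieces v → ∀ x ∈ D.knockoutImage a,
    ∀ y ∈ D.knockoutImage a, WithinDist (D.wallCarrier v) (c * (dist x y + 1)) x y
  aligned : ∀ a : D.Piece, a.IsLevel → a ∈ D.wallPieces v → ∀ (o x : φ.Skel) (t : Option D.Root)
    (o' y : φ.Skel) (t' : Option D.Root), Hang a o x t → Hang a o' y t' → (t ≠ t' ∨ t' = none) →
      dist x o + dist o o' + dist o' y ≤ dist x y + C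

theorem WallBounds.withinDist_hang {v : φ.VPoint} {c C : ℝ} (hw : D.WallBounds v c C)
    {a : D.Piece} (ha : a ∈ D.wallPieces v) {o x : φ.Skel} {t : Option D.Root}
    (hx : Hang a o x t) : WithinDist (D.wallCarrier v) (c * (dist o x + 1)) o x := by
  cases t with
  | none =>
    obtain ⟨rfl, hx⟩ := hx
    refine (WithinDist.refl (knockoutImage_subset ha hx)).mono ?_
    have := hw.one_le
    positivity
  | some τ =>
    obtain ⟨hx, s, hs, rfl⟩ := hx
    exact hw.tunnel τ (endPiece_mem_wallPieces (knockoutOf_subset_wallPieces ha hs)).1 _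
      (endPiece_mem_tunnelCarrier τ s) _ hx

theorem le_dist_endPiece [Finite E] (τ : D.Root) (s : Bool) :
    (D.L : ℝ) ≤ dist (τ.endPiece s).approxPt.toSkel (τ.endPiece !s).approxPt.toSkel := by
  refine le_trans ?_ (abs_skelHeight_sub_le_dist _ _)
  rw [skelHeight_toSkel, skelHeight_toSkel, τ.height_endPiece, τ.height_endPiece]
  cases s <;> simp

theorem Reach.bound [Finite E] {δ c C : ℝ} (h : IsSlim φ.Skel δ) {v : φ.VPoint}
    (hw : D.WallBounds v c C) (hL : 2 * (2 * C + 6 * (δ + 1)) + 2 ≤ D.L) {x : φ.Skel}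
    {t : Option D.Root} {a : D.Piece} (hr : Reach v x t a) :
    ∀ (o y : φ.Skel) (t' : Option D.Root), Hang a o y t' → (t ≠ t' ∨ t' = none) →
      (∃ o₀, dist x o₀ + dist o₀ o + dist o y ≤ dist x y + (2 * C + 6 * (δ + 1))) ∧
      WithinDist (D.wallCarrier v) (2 * c * (dist x y - dist o y) + c * dist o y +
        (3 * c + 2 * c * (2 * C + 6 * (δ + 1)))) x y := by
  have hδ := h.nonneg
  have hC := hw.nonneg
  have hc := hw.one_le
  induction hr with
  | hang a t o₀ ha haw hx =>
    intro o y t' hy htt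
    have h1 := hw.aligned a ha haw o₀ x t o y t' hx hy htt
    refine ⟨⟨o₀, by linarith⟩, ?_⟩
    refine (((hw.withinDist_hang haw hx).symm.trans (hw.knockout a ha haw o₀ (hx.base_mem ha) o
      (hy.base_mem ha))).trans (hw.withinDist_hang haw hy)).mono ?_
    rw [dist_comm o₀ x]
    have h2 : 0 ≤ dist x o₀ + dist o₀ o := by positivity
    have h3 : 2 * c * (dist x o₀ + dist o₀ o) ≤
        2 * c * (dist x y - dist o y + (2 * C + 6 * (δ + 1))) := by
      apply mul_le_mul_of_nonneg_left _ (by linarith); linarith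
    have h4 : 0 ≤ c * (dist x o₀ + dist o₀ o) := by positivity
    linarith
  | step t a τ s ha haw hs ht b hb hr ih =>
    intro o' y t' hy htt
    have hy := hy.congr hb.symm
    set m := (τ.endPiece s).approxPt.toSkel with hm
    set o := (τ.endPiece !s).approxPt.toSkel with ho
    obtain ⟨⟨o₀, h1⟩, h2⟩ := ih m o (some τ) ⟨endPiece_mem_tunnelCarrier τ _, s, hs, rfl⟩ (.inl ht)
    have hLm : (D.L : ℝ) ≤ dist m o := le_dist_endPiece τ s
    have hg : gromovProd m x o ≤ C + 3 * (δ + 1) :=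
      IsSlim.gromovProd_le_of_aligned (o := o₀) (by linarith)
    have hE := τ.isLevel_endPiece !s
    have hEw := (endPiece_mem_wallPieces (knockoutOf_subset_wallPieces haw hs)).2.2 !s
    have hmo : Hang (τ.endPiece !s) o m (some τ) :=
      ⟨endPiece_mem_tunnelCarrier τ _, !s, self_mem_knockoutOf _, rfl⟩
    have h3 := hw.aligned _ hE hEw o m (some τ) o' y t' hmo hy htt
    have h4 := h.aligned_step (L := D.L) (by linarith) hC hg hLm h3
    refine ⟨⟨o, h4⟩, ?_⟩
    refine ((h2.trans (hw.knockout _ hE hEw o (hmo.base_mem hE) o' (hy.base_mem hE))).trans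
      (hw.withinDist_hang hEw hy)).mono ?_
    have h5 : 2 * c * (dist x o + dist o o') ≤
        2 * c * (dist x y - dist o' y + (2 * C + 6 * (δ + 1))) := by
      apply mul_le_mul_of_nonneg_left _ (by linarith); linarith
    have h6 : c * (2 * (2 * C + 6 * (δ + 1)) + 2) ≤ c * dist m o := by
      apply mul_le_mul_of_nonneg_left _ (by linarith); linarith
    have h7 : 0 ≤ c * dist o o' := by positivity
    linarith

/-- A point of `N(A(W̄))¹` is close to a point of a knockout or of a tunnel carrier. -/
theorem exists_hang {Λ : ℝ} {N : ℕ} (hb : φ.EdgeBound Λ N) {v : φ.VPoint} {x : φ.Skel}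
    (hx : x ∈ D.wallCarrier v) : ∃ x₀ a o t, WithinDist (D.wallCarrier v) Λ x x₀ ∧
      a ∈ D.wallPieces v ∧ a.IsLevel ∧ Hang a o x₀ t := by
  obtain ⟨a, ha, hxa⟩ := mem_iUnion₂.1 (carrier_biUnion_subset _ _ hx)
  by_cases hl : a.IsLevel
  · rw [hl.approx_eq] at hxa
    obtain ⟨z, hz, he⟩ := carrier_singleton_subset_cell _ hxa
    obtain rfl : x = z.toSkel := Skel.ext he.symm
    have hm := (mem_knockoutImage hl).2 ⟨a, self_mem_knockoutOf a, rfl⟩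
    have hcell : VPoint.toSkel '' a.approxPt.cell ⊆ D.wallCarrier v := by
      rintro _ ⟨y, hy, rfl⟩
      exact (carrier_isSubcomplex _).cell_subset (x := a.approxPt) (knockoutImage_subset ha hm)
        ⟨y, hy, rfl⟩
    exact ⟨_, a, _, none, hb.withinDist_cell hcell hz (VPoint.self_mem_cell _), ha, hl, rfl, hm⟩
  · unfold Piece.IsLevel at hl
    push Not at hl
    obtain ⟨τ, rfl⟩ := hl
    exact ⟨x, .level τ, _, some τ, (WithinDist.refl hx).mono (zero_le_one.trans hb.one_le),
      slope_mem_wallPieces ha, Piece.isLevel_level τ, carrier_slope_subset τ hxa, false,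
      self_mem_knockoutOf _, rfl⟩

theorem WallBounds.withinDist [Finite E] {δ c C Λ : ℝ} {N : ℕ} (h : IsSlim φ.Skel δ)
    (hb : φ.EdgeBound Λ N) {v : φ.VPoint} (hw : D.WallBounds v c C)
    (hL : 2 * (2 * C + 6 * (δ + 1)) + 2 ≤ D.L) {x y : φ.Skel} (hx : x ∈ D.wallCarrier v)
    (hy : y ∈ D.wallCarrier v) : WithinDist (D.wallCarrier v)
      (2 * c * dist x y + (3 * c + 2 * c * (2 * C + 6 * (δ + 1)) + 2 * Λ + 4 * c * Λ)) x y := by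
  have hδ := h.nonneg
  have hC := hw.nonneg
  have hc := hw.one_le
  obtain ⟨x₀, a, o, t, hxx, haw, hal, hx₀⟩ := exists_hang hb hx
  obtain ⟨y₀, b, o', t', hyy, hbw, hbl, hy₀⟩ := exists_hang hb hy
  have key : WithinDist (D.wallCarrier v)
      (2 * c * dist x₀ y₀ + (3 * c + 2 * c * (2 * C + 6 * (δ + 1)))) x₀ y₀ := by
    rcases exists_reach_hang hal hbl haw hbw hx₀ hy₀ with ⟨τ, hτ, hxτ, hyτ⟩ |
      ⟨s, d, o₁, hr, hd, hst⟩
    · refine (hw.tunnel τ hτ _ hxτ _ hyτ).mono ?_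
      have h1 : 0 ≤ c * dist x₀ y₀ := by positivity
      have h2 : 0 ≤ 2 * c * (2 * C + 6 * (δ + 1)) := by positivity
      linarith
    · refine (hr.bound h hw hL o₁ y₀ t' hd hst).2.mono ?_
      have h1 : 0 ≤ c * dist o₁ y₀ := by positivity
      linarith
  refine ((hxx.trans key).trans hyy.symm).mono ?_
  have h1 := dist_triangle4 x₀ x y y₀
  have h2 := hxx.dist_le
  have h3 := hyy.dist_le
  rw [dist_comm x x₀] at h2
  have h4 : 2 * c * dist x₀ y₀ ≤ 2 * c * (dist x y + 2 * Λ) := by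
    apply mul_le_mul_of_nonneg_left _ (by linarith); linarith
  linarith

end Busts

theorem IsQIEmbedded.withinDist {μ₁ μ₂ : ℝ} {Y : Set φ.Skel} (h : φ.IsQIEmbedded μ₁ μ₂ Y)
    {x y : φ.Skel} (hx : x ∈ Y) (hy : y ∈ Y) :
    WithinDist Y ((|μ₁| * (1 + |μ₂|) + 1) * (dist x y + 1)) x y := by
  obtain ⟨h1, h2, h3⟩ := h
  have h4 := (h3 x hx y hy).1
  have hd : 0 ≤ dist x y := dist_nonneg
  have h0 : 0 ≤ μ₁ := zero_le_one.trans h1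
  rw [edist_dist, ← ENNReal.ofReal_add hd h2, ← ENNReal.ofReal_mul h0] at h4
  have h5 : 0 ≤ μ₁ * (dist x y + μ₂) := by positivity
  refine (WithinDist.of_pathDist_lt (r := μ₁ * (dist x y + μ₂) + 1) (by positivity)
    (h4.trans_lt ((ENNReal.ofReal_lt_ofReal_iff (by positivity)).2 (lt_add_one _)))).mono ?_
  rw [abs_of_nonneg h0, abs_of_nonneg h2]
  have h6 : 0 ≤ μ₁ * μ₂ * dist x y := by positivity
  linarith

theorem isQIEmbedded_of_withinDist {k r : ℝ} (hk : 1 ≤ k) (hr : 0 ≤ r) {Y : Set φ.Skel}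
    (h : ∀ x ∈ Y, ∀ y ∈ Y, WithinDist Y (k * dist x y + r) x y) : φ.IsQIEmbedded k r Y := by
  refine ⟨hk, hr, fun x hx y hy => ⟨?_, ?_⟩⟩
  · rw [edist_dist, ← ENNReal.ofReal_add dist_nonneg hr, ← ENNReal.ofReal_mul (by linarith)]
    refine (h x hx y hy).pathDist_le.trans (ENNReal.ofReal_le_ofReal ?_)
    rw [mul_add]
    have := le_mul_of_one_le_left hr hk
    linarith
  · calc edist x y ≤ φ.pathDist Y x y := edist_le_pathDist Y x y
      _ = 1 * φ.pathDist Y x y := (one_mul _).symm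
      _ ≤ ENNReal.ofReal k * φ.pathDist Y x y := by
        gcongr
        exact ENNReal.one_le_ofReal.2 hk
      _ ≤ _ := le_self_add

theorem Busts.meets_of_endPiece_mem {D : φ.Busts} {τ : D.Root} {s : Bool} {K : Set D.Piece}
    (h : τ.endPiece s ∈ K) : D.Meets τ K := by
  cases s with
  | false => exact .inl h
  | true => exact .inr h

theorem exists_wallBounds [Finite E] {δ : ℝ} (h : IsSlim φ.Skel δ) (μ₁ μ₂ B : ℝ) :
    ∃ c C : ℝ, 1 ≤ c ∧ 0 ≤ C ∧ ∀ 𝕎 : Set φ.ImmersedWall,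
      φ.UniformlySubQuasiconvex μ₁ μ₂ 𝕎 → φ.LadderOverlap δ B 𝕎 →
        ∀ W ∈ 𝕎, ∀ v : φ.VPoint, v.proj = W.point → W.toBusts.WallBounds v c C := by
  obtain ⟨Λ, N, hb⟩ := exists_edgeBound φ
  have hΛ : 0 ≤ Λ := zero_le_one.trans hb.one_le
  set c₀ := 4 * (2 * Λ + N * Λ) with hc₀
  set c₁ := |μ₁| * (1 + |μ₂|) + 1 with hc₁
  have hc₁1 : 1 ≤ c₁ := le_add_of_nonneg_left (by positivity)
  obtain ⟨R₀, hR₀, hq₀⟩ := exists_ladder_mquasiconvex h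
  obtain ⟨R₁, hR₁, hq₁⟩ := h.exists_quasiconvex c₁
  obtain ⟨C₁, hC₁, hg⟩ := h.exists_gromovProd_le skelHeight abs_skelHeight_sub_le_dist c₀
    (max R₀ R₁)
  obtain ⟨C₂, hC₂, hal⟩ := h.exists_aligned skelHeight abs_skelHeight_sub_le_dist c₀
    (max R₀ R₁) φ.ladderConst (max B 0) ladderConst_nonneg (le_max_right _ _)
  refine ⟨max c₀ c₁, max C₂ (2 * C₁), hc₁1.trans (le_max_right _ _), hC₂.trans (le_max_left _ _),
    fun 𝕎 hS hO W hW v hv => ?_⟩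
  have hT : ∀ τ : W.Root, MQuasiconvex (max R₀ R₁) (W.tunnelCarrier τ) := by
    intro τ x hx y hy p hp
    rw [Busts.tunnelCarrier_eq] at *
    obtain ⟨z, hz, hd⟩ := hq₀ _ _ x hx y hy p hp
    exact ⟨z, hz, hd.trans (le_max_left _ _)⟩
  have hTl : ∀ (τ : W.Root) (r : ℝ), φ.ladderConst < r →
      MQuasiconvex r (W.tunnelCarrier τ) := by
    intro τ r hr
    rw [Busts.tunnelCarrier_eq]
    exact ladder_mquasiconvex h hr _ _
  have hQI : ∀ a : W.Piece, a.IsLevel → a ∈ W.wallPieces v →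
      φ.IsQIEmbedded μ₁ μ₂ (W.knockoutImage a) := fun a ha haw =>
    hS W hW v hv _ ⟨a, haw, ha, rfl⟩
  have hK : ∀ a : W.Piece, a.IsLevel → a ∈ W.wallPieces v →
      MQuasiconvex (max R₀ R₁) (W.knockoutImage a) := by
    intro a ha haw x hx y hy p hp
    obtain ⟨z, hz, hd⟩ := hq₁ (W.knockoutImage a) (fun x hx y hy =>
      ((hQI a ha haw).withinDist hx hy).lipJoined) x hx y hy p hp
    exact ⟨z, hz, hd.trans (le_max_right _ _)⟩
  have hTo : ∀ (a : W.Piece), a.IsLevel → ∀ (τ : W.Root) (s : Bool),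
      τ.endPiece s ∈ W.knockoutOf a → ∀ z ∈ W.tunnelCarrier τ,
        dist z (τ.endPiece s).approxPt.toSkel ≤
          c₀ * (|skelHeight z - a.approxPt.height| + 1) := by
    intro a ha τ s hs z hz
    have h1 := Busts.endPiece_mem_tunnelCarrier τ s
    have h2 := Busts.skelHeight_of_mem_knockoutImage ha
      ((Busts.mem_knockoutImage ha).2 ⟨_, hs, rfl⟩)
    rw [← h2]
    rw [Busts.tunnelCarrier_eq] at hz h1
    exact (hb.ladder_withinDist hz h1).dist_le
  refine ⟨hc₁1.trans (le_max_right _ _), hC₂.trans (le_max_left _ _), ?_, ?_, ?_⟩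
  · intro τ hτ x hx y hy
    have h1 := Busts.tunnelCarrier_subset hτ
    rw [Busts.tunnelCarrier_eq] at hx hy h1
    refine ((hb.ladder_withinDist_dist hx hy).mono_set h1).mono ?_
    gcongr
    exact le_max_left _ _
  · intro a ha haw x hx y hy
    refine (((hQI a ha haw).withinDist hx hy).mono_set (Busts.knockoutImage_subset haw)).mono ?_
    gcongr
    exact le_max_right _ _
  · intro a ha haw
    -- a tunnel followed by a knockout
    have mixed : ∀ (o x y : φ.Skel) (τ : W.Root), Busts.Hang a o x (some τ) →
        y ∈ W.knockoutImage a → dist x o + dist o y ≤ dist x y + max C₂ (2 * C₁) := by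
      intro o x y τ hx hy
      have hoK := hx.base_mem ha
      obtain ⟨hxT, s, hs, rfl⟩ := hx
      have h1 := hg _ _ _ _ (hT τ) (hK a ha haw) (hTo a ha τ s hs)
        (fun z hz => Busts.skelHeight_of_mem_knockoutImage ha hz)
        (Busts.endPiece_mem_tunnelCarrier τ s) hoK x hxT y hy
      unfold gromovProd at h1
      rw [dist_comm x]
      linarith [le_max_right C₂ (2 * C₁)]
    intro o x t o' y t' hx hy htt
    have hM : 0 ≤ max C₂ (2 * C₁) := hC₂.trans (le_max_left _ _)
    cases t with
    | none =>
      obtain ⟨rfl, hxK⟩ := hx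
      cases t' with
      | none =>
        obtain ⟨rfl, hyK⟩ := hy
        simpa using hM
      | some τ' =>
        have := mixed o' y o τ' hy hxK
        rw [dist_comm y o', dist_comm o' o, dist_comm y o] at this
        rw [dist_self]
        linarith
    | some τ =>
      cases t' with
      | none =>
        obtain ⟨rfl, hyK⟩ := hy
        have := mixed o x o' τ hx hyK
        rw [dist_self]
        linarith
      | some τ' =>
        have hne : τ ≠ τ' := by
          rintro rfl
          simp at htt
        have hoK := hx.base_mem ha
        have hoK' := hy.base_mem ha
        obtain ⟨hxT, s, hs, rfl⟩ := hx
        obtain ⟨hyT, s', hs', rfl⟩ := hy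
        have hov := hO W hW v hv _ ⟨a, haw, ha, rfl⟩ τ τ' hne (Busts.meets_of_endPiece_mem hs)
          (Busts.meets_of_endPiece_mem hs')
        have := hal _ _ _ _ _ _ (hT τ) (hT τ') (hK a ha haw) (hTl τ) (hTl τ') (hTo a ha τ s hs)
          (hTo a ha τ' s' hs') (fun z hz => Busts.skelHeight_of_mem_knockoutImage ha hz)
          (Busts.endPiece_mem_tunnelCarrier τ s) hoK (Busts.endPiece_mem_tunnelCarrier τ' s') hoK'
          (fun z w hz hz' hw hw' => by
            have h1 := (Metric.edist_le_ediam_of_mem (mem_inter hz hz') (mem_inter hw hw')).trans hov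
            rw [edist_dist] at h1
            rcases le_total 0 B with hB | hB
            · exact ((ENNReal.ofReal_le_ofReal_iff hB).1 h1).trans (le_max_left _ _)
            · rw [ENNReal.ofReal_of_nonpos hB, nonpos_iff_eq_zero, ENNReal.ofReal_eq_zero] at h1
              exact h1.trans (le_max_right _ _)) x hxT y hyT
        linarith [le_max_left C₂ (2 * C₁)]

end GraphMap

theorem mainTheorem5 {V E : Type*} [Finite V] [Finite E] (φ : GraphMap V E) (δ : ℝ)
    (hδ : φ.IsHyperbolic δ) (μ₁ μ₂ B : ℝ) :
    ∃ (L₀ : ℕ) (κ₁ κ₂ : ℝ), ∀ 𝕎 : Set φ.ImmersedWall,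
      φ.UniformlySubQuasiconvex μ₁ μ₂ 𝕎 → φ.LadderOverlap δ B 𝕎 →
        ∀ W ∈ 𝕎, L₀ ≤ W.L → ∀ c : φ.VPoint, c.proj = W.point →
          φ.IsQIEmbedded κ₁ κ₂ (W.approxCarrier c) := by
  have h := hδ.isSlim
  have hδ0 := h.nonneg
  obtain ⟨Λ, N, hb⟩ := GraphMap.exists_edgeBound φ
  have hΛ := hb.one_le
  obtain ⟨c, C, hc, hC, hw⟩ := GraphMap.exists_wallBounds h μ₁ μ₂ B
  obtain ⟨L₀, hL₀⟩ := exists_nat_ge (2 * (2 * C + 6 * (δ + 1)) + 2)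
  refine ⟨L₀, 2 * c, 3 * c + 2 * c * (2 * C + 6 * (δ + 1)) + 2 * Λ + 4 * c * Λ,
    fun 𝕎 hS hO W hW hL v hv => ?_⟩
  have hL' : 2 * (2 * C + 6 * (δ + 1)) + 2 ≤ (W.L : ℝ) := hL₀.trans (by exact_mod_cast hL)
  exact GraphMap.isQIEmbedded_of_withinDist (by linarith) (by positivity) fun x hx y hy =>
    (hw 𝕎 hS hO W hW v hv).withinDist h hb hL' hx hy
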